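/- Let $k$ be an arbitrary field, let $L$ and $K$ be étale $k$-algebras of dimensions $3$ and $2$ respectively, and let $x\mapsto\bar x$ be the non-trivial $k$-automorphism of $K$. Put $E=L\otimes_k K$, $\tau=1\otimes\bar{\ }$, and let $T=\mathbf{SU}(E,\tau)$ be the $k$-torus whose points in a commutative $k$-algebra $R$ are the $g\in(E\otimes_k R)^{*}$ with $g\,\tau(g)=1$ and $N_{E\otimes R/K\otimes R}(g)=1$. Let $H^1(k,T)=H^1(\mathrm{Gal}(k_{sep}/k),T(k_{sep}))$ be the first Galois cohomology group. A pair $(u,\mu)\in L^*\times K^*$ is called admissible if $N_{L/k}(u)=N_{K/k}(\mu)$. For such a pair, the étale Tits process $J(E,\tau,u,\mu)$ is the (quadratic) Jordan algebra on the $k$-space $L\oplus E$ with identity $1=(1,0)$ and cubic norm $$N(a,b)=N_{L/k}(a)+T_{K/k}\big(\mu N_{E/K}(b)\big)-T_{L/k}\big(a\,b\,u\,\tau(b)\big),$$ that is, with $U$-operators $U_xy=T(x,y)x-x^{\#}\times y$, where $$(a,b)^{\#}=\big(a^{\#}-b\,u\,\tau(b),\ \bar\mu\,\tau(b)^{\#}u^{-1}-ab\big),\qquad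 T\big((a,b),(c,d)\big)=T_{L/k}(ac)+T_{E/k}\big(b\,u\,\tau(d)\big),$$ $x\times y=(x+y)^{\#}-x^{\#}-y^{\#}$, and, for an element $c$ of the cubic algebra $L/k$ or $E/K$ whose multiplication map has characteristic polynomial $X^3-tX^2+sX-n$, $c^{\#}=c^2-tc+s$. It contains $L=\{(l,0)\}$ as a subalgebra. Two such algebras are called $L$-isomorphic, $J_1\cong_L J_2$, if there is a $k$-isomorphism of Jordan algebras $J_1\to J_2$ (a $k$-linear bijection preserving the identity and the $U$-operators) which maps the subalgebra $L$ of $J_1$ onto the subalgebra $L$ of $J_2$. **Theorem.** $H^1(k,T)=0$ if and only if $J(E,\tau,u,\mu)\cong_L J(E,\tau,1,1)$ for all admissible pairs $(u,\mu)\in L^*\times K^*$. -/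

import Mathlib

open scoped TensorProduct

/-! ### First Galois cohomology of a commutative module -/

namespace GaloisH1

/-- Continuous (for the discrete topology on `M`, i.e. locally constant) `1`-cocycles
`f : Γ → M`, `f (γ δ) = f γ * γ (f δ)`. -/
def cocycles (Γ M : Type*) [Group Γ] [TopologicalSpace Γ] [CommGroup M]
    [MulDistribMulAction Γ M] : Subgroup (Γ → M) where
  carrier := {f | IsLocallyConstant f ∧ ∀ γ δ : Γ, f (γ * δ) = f γ * γ • f δ}
  one_mem' := ⟨IsLocallyConstant.const 1, fun γ δ => by simp⟩
  mul_mem' := by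
    rintro f g ⟨hf, hf'⟩ ⟨hg, hg'⟩
    refine ⟨hf.mul hg, fun γ δ => ?_⟩
    simp only [Pi.mul_apply, hf', hg', smul_mul']
    exact mul_mul_mul_comm _ _ _ _
  inv_mem' := by
    rintro f ⟨hf, hf'⟩
    refine ⟨hf.inv, fun γ δ => ?_⟩
    simp only [Pi.inv_apply, hf', smul_inv', mul_inv]

/-- The `1`-coboundaries `γ ↦ m⁻¹ * γ m`. -/
def coboundaries (Γ M : Type*) [Group Γ] [CommGroup M] [MulDistribMulAction Γ M] :
    Subgroup (Γ → M) where
  carrier := {f | ∃ m : M, ∀ γ : Γ, f γ = m⁻¹ * γ • m}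
  one_mem' := ⟨1, fun γ => by simp⟩
  mul_mem' := by
    rintro f g ⟨m, hm⟩ ⟨n, hn⟩
    refine ⟨m * n, fun γ => ?_⟩
    simp only [Pi.mul_apply, hm, hn, smul_mul', mul_inv]
    exact mul_mul_mul_comm _ _ _ _
  inv_mem' := by
    rintro f ⟨m, hm⟩
    refine ⟨m⁻¹, fun γ => ?_⟩
    simp only [Pi.inv_apply, hm, smul_inv', mul_inv]

end GaloisH1

/-- `H¹(Γ, M)`: continuous `1`-cocycles modulo `1`-coboundaries. -/
abbrev GaloisH1 (Γ M : Type*) [Group Γ] [TopologicalSpace Γ] [CommGroup M]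
    [MulDistribMulAction Γ M] : Type _ :=
  GaloisH1.cocycles Γ M ⧸
    (GaloisH1.coboundaries Γ M).subgroupOf (GaloisH1.cocycles Γ M)

/-! ### The unitary algebra of a pair `(L, K)` and its torus

The unitary algebra is written `E = K ⊗[k] L` (so that `E` is a `K`-algebra by its left
factor).  For a `k`-algebra `R`, its base change `R ⊗ E` is written `(R ⊗[k] K) ⊗[k] L`, which
is an algebra over `R ⊗[k] K`; the involution is induced by that of `K`. -/

namespace UnitaryTorus

section general

variable {k A : Type*} [Field k] [CommRing A] [Algebra k A]

/-- `τ = s ⊗ 1` on `A ⊗[k] L`, for a `k`-automorphism `s` of `A`. -/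
noncomputable def tau (s : A ≃ₐ[k] A) (L : Type*) [CommRing L] [Algebra k L] :
    (A ⊗[k] L) ≃ₐ[k] (A ⊗[k] L) :=
  Algebra.TensorProduct.congr s AlgEquiv.refl

/-- The group `{g ∈ (A ⊗ L)ˣ | g τ(g) = 1, N_{A ⊗ L / A}(g) = 1}`. -/
noncomputable def specialUnitary (s : A ≃ₐ[k] A) (L : Type*) [CommRing L] [Algebra k L] :
    Subgroup (A ⊗[k] L)ˣ where
  carrier := {g | (g : A ⊗[k] L) * tau s L g = 1 ∧ Algebra.norm A (g : A ⊗[k] L) = 1}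
  one_mem' := by simp
  mul_mem' := by
    rintro g h ⟨hg, hg'⟩ ⟨hh, hh'⟩
    refine ⟨?_, by simp [hg', hh']⟩
    rw [Units.val_mul, map_mul, mul_mul_mul_comm, hg, hh, one_mul]
  inv_mem' := by
    rintro g ⟨hg, hg'⟩
    refine ⟨?_, ?_⟩
    · have h1 : ((g⁻¹ : (A ⊗[k] L)ˣ) : A ⊗[k] L) * g = 1 := g.inv_mul
      have h2 : tau s L ((g⁻¹ : (A ⊗[k] L)ˣ) : A ⊗[k] L) * tau s L g = 1 := by
        rw [← map_mul, h1, map_one]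
      calc ((g⁻¹ : (A ⊗[k] L)ˣ) : A ⊗[k] L) * tau s L ((g⁻¹ : (A ⊗[k] L)ˣ) : A ⊗[k] L)
          = ((g⁻¹ : (A ⊗[k] L)ˣ) : A ⊗[k] L) * tau s L ((g⁻¹ : (A ⊗[k] L)ˣ) : A ⊗[k] L)
              * (g * tau s L g) := by rw [hg, mul_one]
        _ = 1 := by rw [mul_mul_mul_comm, h1, h2, one_mul]
    · have h := congrArg (Algebra.norm A) g.inv_mul
      rwa [map_mul, hg', mul_one, map_one] at h

end general

variable {k K : Type*} [Field k] [CommRing K] [Algebra k K]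

/-- The points `T(R)` of the unitary torus `T = SU(E, τ)` in a commutative `k`-algebra `R`. -/
noncomputable abbrev points (σ : K ≃ₐ[k] K) (L : Type*) [CommRing L] [Algebra k L]
    (R : Type*) [CommRing R] [Algebra k R] : Subgroup ((R ⊗[k] K) ⊗[k] L)ˣ :=
  specialUnitary (A := R ⊗[k] K) (Algebra.TensorProduct.congr AlgEquiv.refl σ) L

/-- The action of `γ` on `R ⊗ E` through the factor `R`. -/
noncomputable def gal (K L : Type*) [CommRing K] [Algebra k K] [CommRing L] [Algebra k L]
    {R : Type*} [CommRing R] [Algebra k R] (γ : R ≃ₐ[k] R) :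
    ((R ⊗[k] K) ⊗[k] L) ≃ₐ[k] ((R ⊗[k] K) ⊗[k] L) :=
  Algebra.TensorProduct.congr (Algebra.TensorProduct.congr γ AlgEquiv.refl) AlgEquiv.refl

theorem gal_one (K L : Type*) [CommRing K] [Algebra k K] [CommRing L] [Algebra k L]
    {R : Type*} [CommRing R] [Algebra k R] (x : (R ⊗[k] K) ⊗[k] L) :
    gal K L (1 : R ≃ₐ[k] R) x = x := by
  have h : (gal K L (1 : R ≃ₐ[k] R)).toAlgHom = AlgHom.id k _ := by
    ext <;> simp [gal]
  exact DFunLike.congr_fun h x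

theorem gal_mul (K L : Type*) [CommRing K] [Algebra k K] [CommRing L] [Algebra k L]
    {R : Type*} [CommRing R] [Algebra k R] (γ δ : R ≃ₐ[k] R) (x : (R ⊗[k] K) ⊗[k] L) :
    gal K L (γ * δ) x = gal K L γ (gal K L δ x) := by
  have h : (gal K L (γ * δ)).toAlgHom = (gal K L γ).toAlgHom.comp (gal K L δ).toAlgHom := by
    ext <;> simp [gal]
  exact DFunLike.congr_fun h x

theorem gal_mem (σ : K ≃ₐ[k] K) (L : Type*) [CommRing L] [Algebra k L]
    {R : Type*} [CommRing R] [Algebra k R] (γ : R ≃ₐ[k] R)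
    {g : ((R ⊗[k] K) ⊗[k] L)ˣ} (hg : g ∈ points σ L R) :
    Units.map (gal K L γ : ((R ⊗[k] K) ⊗[k] L) →* ((R ⊗[k] K) ⊗[k] L)) g ∈ points σ L R := by
  obtain ⟨h1, h2⟩ := hg
  refine ⟨?_, ?_⟩
  · have hc : ∀ x : (R ⊗[k] K) ⊗[k] L,
        tau (Algebra.TensorProduct.congr AlgEquiv.refl σ) L (gal K L γ x) =
          gal K L γ (tau (Algebra.TensorProduct.congr AlgEquiv.refl σ) L x) := by
      intro x
      have h : (tau (Algebra.TensorProduct.congr (AlgEquiv.refl (R := k) (A₁ := R)) σ)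
          L).toAlgHom.comp (gal K L γ).toAlgHom = (gal K L γ).toAlgHom.comp
          (tau (Algebra.TensorProduct.congr (AlgEquiv.refl (R := k) (A₁ := R)) σ)
            L).toAlgHom := by
        ext <;> simp [gal, tau]
      exact DFunLike.congr_fun h x
    change gal K L γ g * tau _ L (gal K L γ g) = 1
    rw [hc, ← map_mul, h1, map_one]
  · change Algebra.norm (R ⊗[k] K) (gal K L γ g) = 1
    have h := Algebra.norm_eq_of_equiv_equiv
      (Algebra.TensorProduct.congr γ (AlgEquiv.refl (R := k) (A₁ := K))).toRingEquiv
      (gal K L γ).toRingEquiv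
      (by
        refine RingHom.ext fun y => ?_
        change (Algebra.TensorProduct.congr γ (AlgEquiv.refl (R := k) (A₁ := K)) y) ⊗ₜ[k]
          (1 : L) = gal K L γ (y ⊗ₜ[k] (1 : L))
        simp [gal])
      (g : (R ⊗[k] K) ⊗[k] L)
    rw [h2] at h
    have h' := congrArg
      (Algebra.TensorProduct.congr γ (AlgEquiv.refl (R := k) (A₁ := K))).toRingEquiv h
    rw [map_one, RingEquiv.apply_symm_apply] at h'
    exact h'.symm

/-- The action of `Aut(R / k)` on `T(R)`; for `R` a separable closure of `k` this is the
Galois action. -/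
noncomputable instance galAction (σ : K ≃ₐ[k] K) (L : Type*) [CommRing L] [Algebra k L]
    (R : Type*) [CommRing R] [Algebra k R] :
    MulDistribMulAction (R ≃ₐ[k] R) (points σ L R) where
  smul γ g := ⟨_, gal_mem σ L γ g.2⟩
  one_smul _ := Subtype.ext (Units.ext (gal_one K L _))
  mul_smul γ δ _ := Subtype.ext (Units.ext (gal_mul K L γ δ _))
  smul_mul _ _ _ := Subtype.ext (map_mul _ _ _)
  smul_one _ := Subtype.ext (map_one _)

end UnitaryTorus

/-! ### Étale Tits processes -/

/-- The adjoint `b^# = b² - T(b) b + S(b)` of a rank `3` commutative `A`-algebra `B`, where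
`X³ - T(b) X² + S(b) X - N(b)` is the characteristic polynomial of multiplication by `b`. -/
noncomputable def cubicAdjoint (A : Type*) {B : Type*} [CommRing A] [CommRing B] [Algebra A B]
    [Module.Free A B] [Module.Finite A B] (b : B) : B :=
  b ^ 2 - algebraMap A B (Algebra.trace A B b) * b +
    algebraMap A B ((LinearMap.mulLeft A b).charpoly.coeff 1)

namespace TitsProcess

variable {k K L : Type*} [Field k] [CommRing K] [Algebra k K] [CommRing L] [Algebra k L]

/-- The norm `N_{E/L} : E → L` for `E = K ⊗[k] L`; one has `N_{E/L}(x) = x τ(x)`. -/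
noncomputable def normEL (x : K ⊗[k] L) : L :=
  Algebra.norm L (Algebra.TensorProduct.comm k K L x)

/-- `(u, μ) ∈ Lˣ × Kˣ` is admissible if `N_{L/k}(u) = N_{K/k}(μ)`. -/
def Admissible (k : Type*) {K L : Type*} [Field k] [CommRing K] [Algebra k K] [CommRing L]
    [Algebra k L] (u : Lˣ) (μ : Kˣ) : Prop :=
  Algebra.norm k (u : L) = Algebra.norm k (μ : K)

/-- The identity element `(1, 0)` of `J(E, τ, u, μ)`. -/
def one : L × (K ⊗[k] L) := (1, 0)

/-- The adjoint `(a, b)^# = (a^# - b u τ(b), μ̄ τ(b)^# u⁻¹ - a b)` of `J(E, τ, u, μ) = L ⊕ E`;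
note `b u τ(b) = u N_{E/L}(b)` lies in `L`. It is the adjoint of the cubic norm
`N(a, b) = N_{L/k}(a) + T_{K/k}(μ N_{E/K}(b)) - T_{L/k}(a b u τ(b))`. -/
noncomputable def adjoint [Module.Finite k L] (σ : K ≃ₐ[k] K) (u : Lˣ) (μ : Kˣ)
    (x : L × (K ⊗[k] L)) : L × (K ⊗[k] L) :=
  (cubicAdjoint k x.1 - u * normEL x.2,
    (σ (μ : K) ⊗ₜ[k] ((u⁻¹ : Lˣ) : L)) * cubicAdjoint K (UnitaryTorus.tau σ L x.2) -
      ((1 : K) ⊗ₜ[k] x.1) * x.2)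

/-- The bilinear trace `T((a, b), (c, d)) = T_{L/k}(a c) + T_{E/k}(b u τ(d))`. -/
noncomputable def traceForm (σ : K ≃ₐ[k] K) (u : Lˣ) (x y : L × (K ⊗[k] L)) : k :=
  Algebra.trace k L (x.1 * y.1) +
    Algebra.trace k (K ⊗[k] L) (x.2 * ((1 : K) ⊗ₜ[k] (u : L)) * UnitaryTorus.tau σ L y.2)

/-- The `U`-operator `U_x y = T(x, y) x - x^# × y` of the (quadratic) Jordan algebra
`J(E, τ, u, μ)`, where `x × y = (x + y)^# - x^# - y^#`. -/
noncomputable def U [Module.Finite k L] (σ : K ≃ₐ[k] K) (u : Lˣ) (μ : Kˣ)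
    (x y : L × (K ⊗[k] L)) : L × (K ⊗[k] L) :=
  traceForm σ u x y • x -
    (adjoint σ u μ (adjoint σ u μ x + y) - adjoint σ u μ (adjoint σ u μ x) - adjoint σ u μ y)

/-- `J(E, τ, u, μ) ≅_L J(E, τ, v, ν)`: there is an isomorphism of Jordan algebras over `k`
(a `k`-linear bijection preserving the identity and the `U`-operators) which maps the
subalgebra `L = {(l, 0)}` onto the subalgebra `L`. -/
def LIsomorphic [Module.Finite k L] (σ : K ≃ₐ[k] K) (u : Lˣ) (μ : Kˣ) (v : Lˣ) (ν : Kˣ) :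
    Prop :=
  ∃ φ : (L × (K ⊗[k] L)) ≃ₗ[k] (L × (K ⊗[k] L)),
    φ one = one ∧
    (∀ x y, φ (U σ u μ x y) = U σ v ν (φ x) (φ y)) ∧
    (LinearMap.range (LinearMap.inl k L (K ⊗[k] L))).map (φ : _ →ₗ[k] _) =
      LinearMap.range (LinearMap.inl k L (K ⊗[k] L))

end TitsProcess

set_option linter.unusedSectionVars false

/-! Both conditions are equivalent to a third: every admissible pair `(u, μ)` is a pair of norms
`(N_{E/L}(w), N_{E/K}(w))` of one `w ∈ E`.

Cohomology: over a separable closure every admissible pair is a pair of norms of some `g`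
(`exists_norms_eq`), and `γ ↦ g⁻¹ γ(g)` is a cocycle in `T`. It is trivial exactly when `g` can be
moved by `T` to an element of `E`. Conversely, Hilbert 90 for the units of `Ks ⊗ E`
(`exists_coboundary`) writes any cocycle in `T` as `v γ(v)⁻¹`, and the norms of `v` form an
admissible pair over `k`.

Jordan algebras: if `w` has norms `(u, μ)`, then `(a, b) ↦ (a, w b)` is an isomorphism onto `J(1,
1)` (`lIsomorphic_one`). Conversely, an isomorphism `φ` preserving `L` restricts to an automorphism
`α` of `L` and maps `E` to `E`. The image of `1 ∈ E` then has norms `α(u)` and either `μ` or its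
conjugate; undoing `α`, and applying `τ` if needed, gives `w` (`exists_norm_eq_of_lIsomorphic_one`).

All identities are checked in coordinates: over a separably closed field `L` has three characters,
`K` has two, swapped by `σ`, and norms, traces and adjoints become symmetric expressions in them. -/

namespace EtaleCoordinates

/-! ### Coordinates on a finite free algebra. -/

section matrix

variable {A B F ι : Type*} [CommRing A] [CommRing B] [Algebra A B] [Field F]
  [Fintype ι] [DecidableEq ι]

/-- If the coordinate functions `ev j`, extending `f`, separate a basis of `B` over `A`, the
characteristic polynomial of `x` has roots `ev j x`. -/
theorem map_charpoly_mulLeft [Module.Free A B] [Module.Finite A B]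
    (b : Module.Basis ι A B) (f : A →+* F) (ev : ι → B →+* F)
    (hev : ∀ j a, ev j (algebraMap A B a) = f a)
    (hdet : (Matrix.of fun i j => ev j (b i)).det ≠ 0) (x : B) :
    (LinearMap.mulLeft A x).charpoly.map f = ∏ j, (Polynomial.X - Polynomial.C (ev j x)) := by
  rw [← LinearMap.charpoly_toMatrix _ b, ← Matrix.charpoly_map]
  set G := LinearMap.toMatrix b b (LinearMap.mulLeft A x) with hG
  set M : Matrix ι ι F := Matrix.of fun i j => ev j (b i) with hM
  -- Evaluating `x * b i` at `ev j` in two ways shows that the invertible matrix `M` diagonalizes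
  -- the transposed multiplication matrix.
  have key : G.transpose.map f * M = M * Matrix.diagonal fun j => ev j x := by
    ext i j
    rw [Matrix.mul_diagonal, Matrix.mul_apply]
    have h := congrArg (ev j) (b.sum_repr (x * b i))
    simp only [map_sum, Algebra.smul_def, map_mul, hev] at h
    simp only [hM, Matrix.of_apply, Matrix.map_apply, Matrix.transpose_apply, hG,
      LinearMap.toMatrix_apply, LinearMap.mulLeft_apply]
    rw [h, mul_comm]
  have hu : IsUnit M := (Matrix.isUnit_iff_isUnit_det _).2 (isUnit_iff_ne_zero.2 hdet)
  obtain ⟨U, hU⟩ := hu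
  have h2 : G.transpose.map f = U.val * (Matrix.diagonal fun j => ev j x) * U⁻¹.val := by
    rw [hU, ← key, ← hU, Units.mul_inv_cancel_right]
  have h3 : (G.map f).charpoly = (G.transpose.map f).charpoly := by
    rw [← Matrix.charpoly_transpose, Matrix.transpose_map]
  rw [h3, h2, Matrix.coe_units_inv, Matrix.charpoly_units_conj, Matrix.charpoly_diagonal]

theorem map_norm [Module.Free A B] [Module.Finite A B]
    (b : Module.Basis ι A B) (f : A →+* F) (ev : ι → B →+* F)
    (hev : ∀ j a, ev j (algebraMap A B a) = f a)
    (hdet : (Matrix.of fun i j => ev j (b i)).det ≠ 0) (x : B) :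
    f (Algebra.norm A x) = ∏ j, ev j x := by
  have := f.domain_nontrivial
  have h := map_charpoly_mulLeft b f ev hev hdet x
  have h0 := congrArg (Polynomial.eval 0) h
  rw [Polynomial.eval_prod] at h0
  simp only [Polynomial.eval_sub, Polynomial.eval_X, Polynomial.eval_C, zero_sub,
    Finset.prod_neg] at h0
  rw [← Polynomial.coeff_zero_eq_eval_zero, Polynomial.coeff_map] at h0
  have h1 : Algebra.norm A x =
      (-1) ^ Module.finrank A B * (LinearMap.mulLeft A x).charpoly.coeff 0 := by
    rw [Algebra.norm_apply, ← LinearMap.det_eq_sign_charpoly_coeff]; rfl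
  rw [h1, map_mul, h0, map_pow, map_neg, map_one, Module.finrank_eq_card_basis b,
    Finset.card_univ, ← mul_assoc, ← mul_pow]
  simp

theorem prod_three_X_sub_C {F : Type*} [CommRing F] (p q r : F) :
    (Polynomial.X - Polynomial.C p) * (Polynomial.X - Polynomial.C q) *
        (Polynomial.X - Polynomial.C r) =
      Polynomial.X ^ 3 - Polynomial.C (p + q + r) * Polynomial.X ^ 2 +
        Polynomial.C (p * q + p * r + q * r) * Polynomial.X - Polynomial.C (p * q * r) := by
  simp only [map_add, map_mul]
  ring

theorem map_trace {A B F : Type*} [CommRing A] [CommRing B] [Algebra A B] [Field F]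
    [Module.Free A B] [Module.Finite A B]
    (b : Module.Basis (Fin 3) A B) (f : A →+* F) (ev : Fin 3 → B →+* F)
    (hev : ∀ j a, ev j (algebraMap A B a) = f a)
    (hdet : (Matrix.of fun i j => ev j (b i)).det ≠ 0) (x : B) :
    f (Algebra.trace A B x) = ev 0 x + ev 1 x + ev 2 x := by
  have := f.domain_nontrivial
  have h := map_charpoly_mulLeft b f ev hev hdet x
  rw [Algebra.trace_apply, LinearMap.trace_eq_matrix_trace A b,
    Matrix.trace_eq_neg_charpoly_coeff, LinearMap.charpoly_toMatrix, map_neg,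
    ← Polynomial.coeff_map]
  change -((LinearMap.mulLeft A x).charpoly.map f).coeff 2 = _
  rw [h, Fin.prod_univ_three, prod_three_X_sub_C]
  simp [-map_add, -map_mul]

/-- If the roots are `p, q, r`, then `p² - (p + q + r) p + (pq + pr + qr) = qr`. The indices `j +
1`, `j + 2` are cyclic in `Fin 3`. -/
theorem map_cubicAdjoint {A B F : Type*} [CommRing A] [CommRing B] [Algebra A B] [Field F]
    [Module.Free A B] [Module.Finite A B]
    (b : Module.Basis (Fin 3) A B) (f : A →+* F) (ev : Fin 3 → B →+* F)
    (hev : ∀ j a, ev j (algebraMap A B a) = f a)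
    (hdet : (Matrix.of fun i j => ev j (b i)).det ≠ 0) (x : B) (j : Fin 3) :
    ev j (cubicAdjoint A x) = ev (j + 1) x * ev (j + 2) x := by
  have := f.domain_nontrivial
  have h := map_charpoly_mulLeft b f ev hev hdet x
  have h1 : f ((LinearMap.mulLeft A x).charpoly.coeff 1) =
      ev 0 x * ev 1 x + ev 0 x * ev 2 x + ev 1 x * ev 2 x := by
    rw [← Polynomial.coeff_map, h, Fin.prod_univ_three, prod_three_X_sub_C]
    simp [-map_add, -map_mul, Polynomial.coeff_C]
  rw [cubicAdjoint, map_add, map_sub, map_mul, map_pow, hev, hev, h1, map_trace b f ev hev hdet]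
  fin_cases j <;> simp <;> ring

theorem coords_injective {I : Type*} (b : Module.Basis ι A B) (f : I → A →+* F)
    (ev : I → ι → B →+* F) (hev : ∀ i j a, ev i j (algebraMap A B a) = f i a)
    (hdet : ∀ i, (Matrix.of fun l j => ev i j (b l)).det ≠ 0)
    (hf : ∀ a, (∀ i, f i a = 0) → a = 0) (x : B) (hx : ∀ i j, ev i j x = 0) : x = 0 := by
  refine b.ext_elem fun l => ?_
  rw [map_zero, Finsupp.zero_apply]
  refine hf _ fun i => ?_
  refine congrFun (Matrix.eq_zero_of_vecMul_eq_zero (hdet i)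
    (v := fun l => f i (b.repr x l)) ?_) l
  ext j
  have h := congrArg (ev i j) (b.sum_repr x)
  simp only [map_sum, Algebra.smul_def, map_mul, hev, hx] at h
  exact h

theorem coords_surjective {I : Type*} (b : Module.Basis ι A B) (f : I → A →+* F)
    (ev : I → ι → B →+* F) (hev : ∀ i j a, ev i j (algebraMap A B a) = f i a)
    (hdet : ∀ i, (Matrix.of fun l j => ev i j (b l)).det ≠ 0)
    (hf : ∀ z : I → F, ∃ a, ∀ i, f i a = z i) (z : I → ι → F) : ∃ x, ∀ i j, ev i j x = z i j := by
  choose a ha using fun l => hf fun i =>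
    Matrix.vecMul (z i) (Matrix.of fun l j => ev i j (b l))⁻¹ l
  refine ⟨∑ l, a l • b l, fun i j => ?_⟩
  simp only [map_sum, Algebra.smul_def, map_mul, hev, ha]
  have h : Matrix.vecMul (Matrix.vecMul (z i) (Matrix.of fun l j => ev i j (b l))⁻¹)
      (Matrix.of fun l j => ev i j (b l)) = z i := by
    rw [Matrix.vecMul_vecMul, Matrix.nonsing_inv_mul _ (isUnit_iff_ne_zero.2 (hdet i)),
      Matrix.vecMul_one]
  exact congrFun h j

end matrix

/-! ### Characters of étale algebras. -/

section field

variable {k B F ι : Type*} [Field k] [CommRing B] [Algebra k B] [Field F] [Algebra k F]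
  [Fintype ι]

theorem eq_zero_of_sum_algHom_eq_zero {lam : ι → B →ₐ[k] F} (hlam : Function.Injective lam)
    (c : ι → F) (h : ∀ x, ∑ j, c j * lam j x = 0) (j : ι) : c j = 0 := by
  have h1 := (linearIndependent_algHom_toLinearMap k B F).comp lam hlam
  rw [Fintype.linearIndependent_iff] at h1
  refine h1 c ?_ j
  ext x
  simpa using h x

/-- A kernel vector would be a linear relation between distinct characters, against Dedekind's
independence. -/
theorem det_algHom_ne_zero [DecidableEq ι] {lam : ι → B →ₐ[k] F} (hlam : Function.Injective lam)
    (b : Module.Basis ι k B) : (Matrix.of fun i j => lam j (b i)).det ≠ 0 := by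
  intro h
  obtain ⟨v, hv, hv0⟩ := Matrix.exists_mulVec_eq_zero_iff.2 h
  refine hv (funext fun j => eq_zero_of_sum_algHom_eq_zero hlam v (fun x => ?_) j)
  have h2 : (∑ j, v j • (lam j).toLinearMap : B →ₗ[k] F) = 0 := by
    refine b.ext fun i => ?_
    have := congrFun hv0 i
    simpa [Matrix.mulVec, dotProduct, mul_comm] using this
  simpa using LinearMap.congr_fun h2 x

/-- The characters are the projections of `F ⊗ B ≅ F^n`; the idempotents of `F^n` tell them apart.
-/
theorem exists_injective_algHom [Algebra.Etale k B] [Module.Finite k B] [IsSepClosed F] {n : ℕ}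
    (hn : Module.finrank k B = n) : ∃ lam : Fin n → B →ₐ[k] F, Function.Injective lam := by
  obtain ⟨m, ⟨e⟩⟩ := Algebra.IsFiniteSplit.nonempty_algEquiv_fun F (F ⊗[k] B)
  have hm : m = n := by
    have := e.toLinearEquiv.finrank_eq
    rw [Module.finrank_baseChange, hn, Module.finrank_fin_fun] at this
    exact this.symm
  subst hm
  refine ⟨fun i => ((Pi.evalAlgHom F (fun _ : Fin m => F) i).comp e.toAlgHom).restrictScalars k
    |>.comp Algebra.TensorProduct.includeRight, fun i j hij => ?_⟩
  have h : (Pi.evalAlgHom F (fun _ : Fin m => F) i).comp e.toAlgHom =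
      (Pi.evalAlgHom F (fun _ : Fin m => F) j).comp e.toAlgHom := by
    refine Algebra.TensorProduct.ext (by ext) ?_
    exact hij
  by_contra hne
  have h2 := DFunLike.congr_fun h (e.symm (Pi.single i 1))
  simp [Ne.symm hne] at h2

end field

/-! ### Coordinates on tensor products. -/

section tensor

variable {k A B F : Type*} [Field k] [CommRing A] [Algebra k A] [CommRing B] [Algebra k B]
  [Field F] [Algebra k F]

/-- The coordinate of `A ⊗ B` attached to a pair of coordinates of `A` and of `B`. -/
noncomputable abbrev coord (f : A →ₐ[k] F) (g : B →ₐ[k] F) : A ⊗[k] B →ₐ[k] F :=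
  Algebra.TensorProduct.productMap f g

theorem det_coord_ne_zero {n : ℕ} {lam : Fin n → B →ₐ[k] F} (hlam : Function.Injective lam)
    (b : Module.Basis (Fin n) k B) (f : A →ₐ[k] F) :
    (Matrix.of fun i j => (coord f (lam j) : A ⊗[k] B →+* F)
      (Algebra.TensorProduct.basis A b i)).det ≠ 0 := by
  simpa using det_algHom_ne_zero hlam b

theorem coord_tau (s : A ≃ₐ[k] A) (f : A →ₐ[k] F) (g : B →ₐ[k] F) (x : A ⊗[k] B) :
    coord f g (UnitaryTorus.tau s B x) = coord (f.comp s.toAlgHom) g x := by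
  have h : (coord f g).comp (UnitaryTorus.tau s B).toAlgHom = coord (f.comp s.toAlgHom) g := by
    ext <;> simp [UnitaryTorus.tau]
  exact DFunLike.congr_fun h x

variable [Module.Finite k B]

theorem coord_norm {n : ℕ} (hn : Module.finrank k B = n) {lam : Fin n → B →ₐ[k] F}
    (hlam : Function.Injective lam) (f : A →ₐ[k] F) (x : A ⊗[k] B) :
    f (Algebra.norm A x) = ∏ j, coord f (lam j) x :=
  map_norm (Algebra.TensorProduct.basis A (Module.finBasisOfFinrankEq k B hn)) (f : A →+* F)
    (fun j => (coord f (lam j) : A ⊗[k] B →+* F)) (fun j a => by simp)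
    (det_coord_ne_zero hlam _ f) x

theorem coord_cubicAdjoint (hn : Module.finrank k B = 3) {lam : Fin 3 → B →ₐ[k] F}
    (hlam : Function.Injective lam) (f : A →ₐ[k] F) (x : A ⊗[k] B) (j : Fin 3) :
    coord f (lam j) (cubicAdjoint A x) = coord f (lam (j + 1)) x * coord f (lam (j + 2)) x :=
  map_cubicAdjoint (Algebra.TensorProduct.basis A (Module.finBasisOfFinrankEq k B hn))
    (f : A →+* F) (fun j => (coord f (lam j) : A ⊗[k] B →+* F)) (fun j a => by simp)
    (det_coord_ne_zero hlam _ f) x j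

theorem coord_ext {n : ℕ} (hn : Module.finrank k B = n) {lam : Fin n → B →ₐ[k] F}
    (hlam : Function.Injective lam) {I : Type*} {f : I → A →ₐ[k] F}
    (hf : ∀ a, (∀ i, f i a = 0) → a = 0) {x y : A ⊗[k] B}
    (h : ∀ i j, coord (f i) (lam j) x = coord (f i) (lam j) y) : x = y :=
  sub_eq_zero.1 <| coords_injective (F := F)
    (Algebra.TensorProduct.basis A (Module.finBasisOfFinrankEq k B hn))
    (fun i => (f i : A →+* F)) (fun i j => (coord (f i) (lam j) : A ⊗[k] B →+* F))
    (fun i j a => by simp) (fun i => det_coord_ne_zero hlam _ (f i)) hf (x - y)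
    (fun i j => by
      change coord (f i) (lam j) (x - y) = 0
      rw [map_sub, h, sub_self])

theorem coord_surjective {n : ℕ} (hn : Module.finrank k B = n) {lam : Fin n → B →ₐ[k] F}
    (hlam : Function.Injective lam) {I : Type*} {f : I → A →ₐ[k] F}
    (hf : ∀ z : I → F, ∃ a, ∀ i, f i a = z i) (z : I → Fin n → F) :
    ∃ x : A ⊗[k] B, ∀ i j, coord (f i) (lam j) x = z i j :=
  coords_surjective
    (Algebra.TensorProduct.basis A (Module.finBasisOfFinrankEq k B hn))
    (fun i => (f i : A →+* F)) (fun i j => (coord (f i) (lam j) : A ⊗[k] B →+* F))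
    (fun i j a => by simp) (fun i => det_coord_ne_zero hlam _ (f i)) hf z

theorem algHom_norm {n : ℕ} (hn : Module.finrank k B = n) {lam : Fin n → B →ₐ[k] F}
    (hlam : Function.Injective lam) (x : B) :
    algebraMap k F (Algebra.norm k x) = ∏ j, lam j x :=
  map_norm (Module.finBasisOfFinrankEq k B hn) (algebraMap k F) (fun j => (lam j : B →+* F))
    (fun j a => by simp) (det_algHom_ne_zero hlam _) x

theorem algHom_cubicAdjoint (hn : Module.finrank k B = 3) {lam : Fin 3 → B →ₐ[k] F}
    (hlam : Function.Injective lam) (x : B) (j : Fin 3) :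
    lam j (cubicAdjoint k x) = lam (j + 1) x * lam (j + 2) x :=
  map_cubicAdjoint (Module.finBasisOfFinrankEq k B hn)
    (algebraMap k F) (fun j => (lam j : B →+* F)) (fun j a => by simp)
    (det_algHom_ne_zero hlam _) x j

theorem algHom_trace (hn : Module.finrank k B = 3) {lam : Fin 3 → B →ₐ[k] F}
    (hlam : Function.Injective lam) (x : B) :
    algebraMap k F (Algebra.trace k B x) = lam 0 x + lam 1 x + lam 2 x :=
  map_trace (Module.finBasisOfFinrankEq k B hn)
    (algebraMap k F) (fun j => (lam j : B →+* F)) (fun j a => by simp)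
    (det_algHom_ne_zero hlam _) x

theorem algHom_ext {n : ℕ} (hn : Module.finrank k B = n) {lam : Fin n → B →ₐ[k] F}
    (hlam : Function.Injective lam) {x y : B} (h : ∀ j, lam j x = lam j y) : x = y :=
  sub_eq_zero.1 <| coords_injective (F := F) (I := Unit) (Module.finBasisOfFinrankEq k B hn)
    (fun _ => algebraMap k F) (fun _ j => (lam j : B →+* F))
    (fun i j a => by simp) (fun i => det_algHom_ne_zero hlam _)
    (fun a ha => (algebraMap k F).injective (by simpa using ha ())) (x - y)
    (fun i j => by
      change lam j (x - y) = 0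
      rw [map_sub, h, sub_self])

end tensor

/-! ### Coordinates adapted to `(L, K, σ)`. -/

section unitary

variable {k K L F : Type*} [Field k] [CommRing L] [Algebra k L] [CommRing K] [Algebra k K]
  [Field F] [Algebra k F]

/-- Composition with `σ` permutes the two characters of `K`. If it fixed one it would fix both, and
`σ` would be the identity. -/
theorem algHom_comp_eq_of_ne_refl [Module.Finite k K] (hK : Module.finrank k K = 2)
    {kap : Fin 2 → K →ₐ[k] F} (hkap : Function.Injective kap) {σ : K ≃ₐ[k] K}
    (hσ : σ ≠ AlgEquiv.refl) (i : Fin 2) : (kap i).comp σ.toAlgHom = kap (i + 1) := by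
  have hcard : Nat.card (K →ₐ[k] F) ≤ 2 := hK ▸ card_algHom_le_finrank k K F
  have hs : Function.Surjective kap := by
    have : Fintype (K →ₐ[k] F) := Fintype.ofFinite _
    rw [Nat.card_eq_fintype_card] at hcard
    refine ((Fintype.bijective_iff_injective_and_card kap).2 ⟨hkap, le_antisymm ?_ ?_⟩).2
    · exact Fintype.card_le_of_injective kap hkap
    · simpa using hcard
  have hinj : Function.Injective fun i => (kap i).comp σ.toAlgHom := by
    intro i j hij
    refine hkap (AlgHom.ext fun x => ?_)
    simpa using DFunLike.congr_fun hij (σ.symm x)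
  have hne : ∀ i, (kap i).comp σ.toAlgHom ≠ kap i := by
    intro i hi
    have h2 : (kap (i + 1)).comp σ.toAlgHom = kap (i + 1) := by
      obtain ⟨j, hj⟩ := hs ((kap (i + 1)).comp σ.toAlgHom)
      have : j ≠ i := by
        rintro rfl
        have := hinj (hj.symm.trans hi.symm)
        revert this
        fin_cases j <;> decide
      have : j = i + 1 := by fin_cases i <;> fin_cases j <;> simp_all
      rw [← hj, this]
    refine hσ (AlgEquiv.ext fun x => algHom_ext hK hkap fun j => ?_)
    have : j = i ∨ j = i + 1 := by fin_cases i <;> fin_cases j <;> simp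
    rcases this with rfl | rfl
    · exact DFunLike.congr_fun hi x
    · exact DFunLike.congr_fun h2 x
  obtain ⟨j, hj⟩ := hs ((kap i).comp σ.toAlgHom)
  have : j ≠ i := by
    rintro rfl
    exact hne j hj.symm
  have : j = i + 1 := by fin_cases i <;> fin_cases j <;> simp_all
  rw [← hj, this]

theorem algHom_normEL [Module.Finite k K] (hK : Module.finrank k K = 2)
    {kap : Fin 2 → K →ₐ[k] F} (hkap : Function.Injective kap) (g : L →ₐ[k] F) (x : K ⊗[k] L) :
    g (TitsProcess.normEL x) = coord (kap 0) g x * coord (kap 1) g x := by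
  have h : ∀ f : K →ₐ[k] F,
      coord g f (Algebra.TensorProduct.comm k K L x) = coord f g x := fun f => by
    have h : (coord g f).comp (Algebra.TensorProduct.comm k K L).toAlgHom = coord f g := by
      ext <;> simp
    exact DFunLike.congr_fun h x
  rw [TitsProcess.normEL, coord_norm hK hkap, Fin.prod_univ_two, h, h]

/-- A splitting over `F` of the étale algebras `L` and `K` of dimensions `3` and `2`. -/
structure Splitting (σ : K ≃ₐ[k] K) (L F : Type*) [CommRing L] [Algebra k L] [Field F]
    [Algebra k F] : Type _ where
  /-- the coordinates of `K` -/
  kap : Fin 2 → K →ₐ[k] F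
  /-- the coordinates of `L` -/
  lam : Fin 3 → L →ₐ[k] F
  kap_injective : Function.Injective kap
  lam_injective : Function.Injective lam
  finrank_K : Module.finrank k K = 2
  finrank_L : Module.finrank k L = 3
  kap_comp : ∀ i, (kap i).comp σ.toAlgHom = kap (i + 1)

namespace Splitting

variable [Module.Finite k K] [Module.Finite k L] {σ : K ≃ₐ[k] K} (c : Splitting σ L F)

theorem nonempty [Algebra.Etale k K] [Algebra.Etale k L] [IsSepClosed F]
    (hL : Module.finrank k L = 3) (hK : Module.finrank k K = 2) (hσ : σ ≠ AlgEquiv.refl) :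
    Nonempty (Splitting σ L F) := by
  obtain ⟨kap, hkap⟩ := exists_injective_algHom (F := F) hK
  obtain ⟨lam, hlam⟩ := exists_injective_algHom (F := F) hL
  exact ⟨⟨kap, lam, hkap, hlam, hK, hL, algHom_comp_eq_of_ne_refl hK hkap hσ⟩⟩

/-- The coordinates of `K ⊗ L`. -/
noncomputable abbrev ev (i : Fin 2) (j : Fin 3) : K ⊗[k] L →ₐ[k] F := coord (c.kap i) (c.lam j)

theorem extK {x y : K} (h : ∀ i, c.kap i x = c.kap i y) : x = y :=
  algHom_ext c.finrank_K c.kap_injective h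

theorem extL {x y : L} (h : ∀ i, c.lam i x = c.lam i y) : x = y :=
  algHom_ext c.finrank_L c.lam_injective h

theorem extE {x y : K ⊗[k] L} (h : ∀ i j, c.ev i j x = c.ev i j y) : x = y :=
  coord_ext c.finrank_L c.lam_injective
    (fun a ha => c.extK (by simpa using ha)) h

theorem ev_tmul (i : Fin 2) (j : Fin 3) (x : K) (y : L) :
    c.ev i j (x ⊗ₜ y) = c.kap i x * c.lam j y := by
  simp

theorem kap_σ (i : Fin 2) (x : K) : c.kap i (σ x) = c.kap (i + 1) x :=
  DFunLike.congr_fun (c.kap_comp i) x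

theorem ev_tau (i : Fin 2) (j : Fin 3) (x : K ⊗[k] L) :
    c.ev i j (UnitaryTorus.tau σ L x) = c.ev (i + 1) j x := by
  rw [ev, coord_tau, c.kap_comp]

theorem lam_normEL (i : Fin 2) (j : Fin 3) (x : K ⊗[k] L) :
    c.lam j (TitsProcess.normEL x) = c.ev i j x * c.ev (i + 1) j x := by
  rw [algHom_normEL c.finrank_K c.kap_injective]
  fin_cases i
  · rfl
  · exact mul_comm _ _

theorem kap_norm (i : Fin 2) (j : Fin 3) (x : K ⊗[k] L) :
    c.kap i (Algebra.norm K x) = c.ev i j x * c.ev i (j + 1) x * c.ev i (j + 2) x := by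
  rw [coord_norm c.finrank_L c.lam_injective, Fin.prod_univ_three]
  fin_cases j
  · rfl
  · exact (mul_rotate _ _ _)
  · exact (mul_rotate _ _ _).symm

theorem ev_cubicAdjoint (i : Fin 2) (j : Fin 3) (x : K ⊗[k] L) :
    c.ev i j (cubicAdjoint K x) = c.ev i (j + 1) x * c.ev i (j + 2) x :=
  coord_cubicAdjoint c.finrank_L c.lam_injective _ _ _

theorem lam_cubicAdjoint (j : Fin 3) (x : L) :
    c.lam j (cubicAdjoint k x) = c.lam (j + 1) x * c.lam (j + 2) x :=
  algHom_cubicAdjoint c.finrank_L c.lam_injective _ _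

theorem lam_trace (j : Fin 3) (x : L) :
    algebraMap k F (Algebra.trace k L x) = c.lam j x + c.lam (j + 1) x + c.lam (j + 2) x := by
  rw [algHom_trace c.finrank_L c.lam_injective]
  fin_cases j
  · rfl
  · exact (add_rotate _ _ _)
  · exact (add_rotate _ _ _).symm

theorem norm_eq (x : L) (j : Fin 3) :
    algebraMap k F (Algebra.norm k x) = c.lam j x * c.lam (j + 1) x * c.lam (j + 2) x := by
  rw [algHom_norm c.finrank_L c.lam_injective, Fin.prod_univ_three]
  fin_cases j
  · rfl
  · exact (mul_rotate _ _ _)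
  · exact (mul_rotate _ _ _).symm

theorem norm_eqK (x : K) (i : Fin 2) :
    algebraMap k F (Algebra.norm k x) = c.kap i x * c.kap (i + 1) x := by
  rw [algHom_norm c.finrank_K c.kap_injective, Fin.prod_univ_two]
  fin_cases i
  · rfl
  · exact mul_comm _ _

end Splitting

end unitary

/-! ### From norms to isomorphisms, and `U`-operators on the two summands. -/

namespace Splitting

variable {k K L F : Type*} [Field k] [CommRing L] [Algebra k L] [CommRing K] [Algebra k K]
  [Field F] [Algebra k F] [Module.Finite k K] [Module.Finite k L] {σ : K ≃ₐ[k] K}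
  (c : Splitting σ L F)

theorem fin_two_add (i : Fin 2) : i + 1 + 1 = i := by fin_cases i <;> rfl

theorem fin_three_add (j : Fin 3) : j + 1 + 1 = j + 2 ∧ j + 1 + 2 = j ∧ j + 2 + 1 = j ∧
    j + 2 + 2 = j + 1 := by fin_cases j <;> decide

include c

theorem one_tmul_normEL (x : K ⊗[k] L) :
    (1 : K) ⊗ₜ[k] TitsProcess.normEL x = x * UnitaryTorus.tau σ L x :=
  c.extE fun i j => by
    rw [c.ev_tmul, map_one, one_mul, c.lam_normEL i, map_mul, c.ev_tau]

theorem normEL_zero : TitsProcess.normEL (0 : K ⊗[k] L) = 0 :=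
  c.extL fun j => by rw [c.lam_normEL 0]; simp

theorem cubicAdjointL_zero : cubicAdjoint k (0 : L) = 0 :=
  c.extL fun j => by rw [c.lam_cubicAdjoint]; simp

theorem cubicAdjointE_zero : cubicAdjoint K (0 : K ⊗[k] L) = 0 :=
  c.extE fun i j => by rw [c.ev_cubicAdjoint]; simp

theorem lam_inv (j : Fin 3) (u : Lˣ) : c.lam j (u : L) * c.lam j ((u⁻¹ : Lˣ) : L) = 1 := by
  rw [← map_mul, Units.mul_inv, map_one]

/-- The map `(a, b) ↦ (a, w b)` works: `u = w τ(w)` matches the traces and the `L`-component of the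
adjoint, and `w μ̄ u⁻¹ = τ(w)^#` matches its `E`-component. -/
theorem lIsomorphic_one {u : Lˣ} {μ : Kˣ} {w : K ⊗[k] L} (hu : TitsProcess.normEL w = u)
    (hμ : Algebra.norm K w = μ) : TitsProcess.LIsomorphic σ u μ 1 1 := by
  have hunit : IsUnit w := by
    refine isUnit_of_mul_isUnit_left (y := UnitaryTorus.tau σ L w) ?_
    rw [← c.one_tmul_normEL, hu]
    exact u.isUnit.map (Algebra.TensorProduct.includeRight : L →ₐ[k] K ⊗[k] L)
  obtain ⟨w, rfl⟩ := hunit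
  let φ : (L × (K ⊗[k] L)) ≃ₗ[k] (L × (K ⊗[k] L)) :=
    (LinearEquiv.refl k L).prodCongr (LinearEquiv.ofLinearMap
      (LinearMap.mulLeft k (w : K ⊗[k] L)) (LinearMap.mulLeft k ((w⁻¹ : (K ⊗[k] L)ˣ) : K ⊗[k] L))
      (by ext x; simp) (by ext x; simp))
  have hφ : ∀ x, φ x = (x.1, w * x.2) := fun x => rfl
  have hadj : ∀ x, φ (TitsProcess.adjoint σ u μ x) = TitsProcess.adjoint σ 1 1 (φ x) := by
    rintro ⟨a, b⟩
    rw [hφ, hφ]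
    refine Prod.ext (c.extL fun j => ?_) (c.extE fun i j => ?_)
    · simp only [TitsProcess.adjoint, map_sub, map_mul, c.lam_normEL 0, ← hu]
      simp
      ring
    · have h1 := c.lam_inv j u
      rw [← hu, c.lam_normEL i] at h1
      simp only [TitsProcess.adjoint, map_sub, map_mul, c.ev_tmul, c.ev_cubicAdjoint, c.ev_tau,
        c.kap_σ, ← hμ, c.kap_norm _ j]
      simp only [Units.val_one, inv_one, map_one]
      linear_combination (c.ev (i + 1) (j + 1) w * c.ev (i + 1) (j + 2) w *
        c.ev (i + 1) (j + 1) b * c.ev (i + 1) (j + 2) b) * h1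
  have htr : ∀ x y, TitsProcess.traceForm σ 1 (φ x) (φ y) = TitsProcess.traceForm σ u x y := by
    rintro ⟨a, b⟩ ⟨a', b'⟩
    rw [hφ, hφ, TitsProcess.traceForm, TitsProcess.traceForm]
    congr 2
    refine c.extE fun i j => ?_
    simp only [map_mul, c.ev_tmul, c.ev_tau, ← hu, c.lam_normEL i, Units.val_one, map_one]
    ring
  refine ⟨φ, ?_, fun x y => ?_, ?_⟩
  · simp [hφ, TitsProcess.one]
  · rw [TitsProcess.U, TitsProcess.U, htr, ← hadj, ← hadj, ← hadj, ← map_add, ← hadj]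
    simp only [map_sub, map_smul]
  · ext x
    simp only [Submodule.mem_map, LinearMap.mem_range, LinearMap.inl_apply]
    constructor
    · rintro ⟨_, ⟨a, rfl⟩, rfl⟩
      exact ⟨a, by simp [hφ]⟩
    · rintro ⟨a, rfl⟩
      exact ⟨_, ⟨a, rfl⟩, by simp [hφ]⟩

/-- Elements of `L` act differently on the two summands, by `a²` on `L` and by `a^#` on `E`. This
makes `E` recognizable from `L` and the `U`-operators. -/
theorem U_inl (u : Lˣ) (μ : Kˣ) (a d : L) (b : K ⊗[k] L) :
    TitsProcess.U σ u μ (a, 0) (d, b) = (a ^ 2 * d, (1 : K) ⊗ₜ[k] cubicAdjoint k a * b) := by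
  have h : ∀ d : L, TitsProcess.adjoint σ u μ (d, 0) = (cubicAdjoint k d, 0) := fun d => by
    simp [TitsProcess.adjoint, c.normEL_zero, c.cubicAdjointE_zero]
  rw [TitsProcess.U, h, h, Prod.mk_add_mk, zero_add]
  refine Prod.ext (c.extL fun j => ?_) (c.extE fun i j => ?_)
  · have ht : TitsProcess.traceForm σ u (a, 0) (d, b) = Algebra.trace k L (a * d) := by
      simp [TitsProcess.traceForm]
    obtain ⟨h1, h2, h3, h4⟩ := fin_three_add j
    simp only [ht, TitsProcess.adjoint, Prod.fst_sub, Prod.smul_fst]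
    simp only [Algebra.smul_def, map_sub, map_mul, AlgHom.commutes, c.lam_trace j,
      c.lam_cubicAdjoint, map_add, map_pow, h1, h2, h3, h4]
    ring
  · simp only [TitsProcess.adjoint, Prod.snd_sub, Prod.smul_snd, smul_zero, map_sub,
      map_mul, c.ev_tmul, map_add, map_zero]
    ring

/-- As `d` varies, the first component determines `u N_{E/L}(b)` and the second one the `E`-part of
`(0, b)^#`; these carry `u` and `μ`. -/
theorem U_inr (u : Lˣ) (μ : Kˣ) (d : L) (b : K ⊗[k] L) :
    TitsProcess.U σ u μ (0, b) (d, 0) =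
      (-(cubicAdjoint k (d - u * TitsProcess.normEL b) -
        cubicAdjoint k (-(u * TitsProcess.normEL b)) - cubicAdjoint k d),
        (1 : K) ⊗ₜ[k] d * (TitsProcess.adjoint σ u μ (0, b)).2) := by
  have h : TitsProcess.adjoint σ u μ (0, b) =
      (-(u * TitsProcess.normEL b), (TitsProcess.adjoint σ u μ (0, b)).2) := by
    simp [TitsProcess.adjoint, c.cubicAdjointL_zero]
  have ht : TitsProcess.traceForm σ u (0, b) (d, 0) = 0 := by simp [TitsProcess.traceForm]
  rw [TitsProcess.U, ht, zero_smul, h]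
  refine Prod.ext ?_ ?_
  · simp only [TitsProcess.adjoint, Prod.fst_sub, Prod.mk_add_mk, Prod.fst_zero, add_zero,
      c.normEL_zero]
    rw [show -(u * TitsProcess.normEL b) + d = d - u * TitsProcess.normEL b by ring]
    ring
  · simp only [TitsProcess.adjoint, Prod.snd_sub, Prod.mk_add_mk, Prod.snd_zero, add_zero, map_zero,
      c.cubicAdjointE_zero, TensorProduct.tmul_add]
    ring

end Splitting

/-! ### Maps compatible with `a²d` are multiplicative. -/

section squares

variable {k L F : Type*} [Field k] [CommRing L] [Algebra k L] [Field F] [Algebra k F]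
  [Module.Finite k L]

/-- A separable algebra is spanned by its squares. -/
theorem span_squares_eq_top {n : ℕ} (hn : Module.finrank k L = n) {lam : Fin n → L →ₐ[k] F}
    (hlam : Function.Injective lam) : Submodule.span k (Set.range fun a : L => a ^ 2) = ⊤ := by
  -- In characteristic 2 the squares of a basis are again a basis, since their evaluation matrix is
  -- the Frobenius image of an invertible one. Otherwise `2a = (a + 1)² - a² - 1`.
  by_cases h2 : (2 : k) = 0
  · have : CharP F 2 := by
      refine CharTwo.of_one_ne_zero_of_two_eq_zero one_ne_zero ?_
      rw [← map_ofNat (algebraMap k F) 2, h2, map_zero]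
    let b := Module.finBasisOfFinrankEq k L hn
    have hdet := det_algHom_ne_zero hlam b
    have hdet2 : (Matrix.of fun i j => lam j (b i ^ 2)).det ≠ 0 := by
      have h : (Matrix.of fun i j => lam j (b i ^ 2)) =
          (frobenius F 2).mapMatrix (Matrix.of fun i j => lam j (b i)) := by
        ext i j
        simp [frobenius_def]
      rw [h, ← RingHom.map_det]
      simpa [frobenius_def] using hdet
    have hli : LinearIndependent k fun i => b i ^ 2 := by
      rw [Fintype.linearIndependent_iff]
      intro g hg i
      have h0 : (fun i => algebraMap k F (g i)) = 0 := by
        refine Matrix.eq_zero_of_vecMul_eq_zero hdet2 ?_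
        ext j
        have := congrArg (lam j) hg
        simpa [Matrix.vecMul, dotProduct, Algebra.smul_def] using this
      simpa using congrFun h0 i
    have := hli.span_eq_top_of_card_eq_finrank' (by simp [hn])
    rw [eq_top_iff, ← this, Submodule.span_le]
    rintro _ ⟨i, rfl⟩
    exact Submodule.subset_span ⟨b i, rfl⟩
  · rw [eq_top_iff]
    intro a _
    have h : a = (2 : k)⁻¹ • ((a + 1) ^ 2 - a ^ 2 - 1 ^ 2) := by
      rw [show (a + 1) ^ 2 - a ^ 2 - 1 ^ 2 = (2 : k) • a by
        rw [Algebra.smul_def, map_ofNat]; ring, smul_smul, inv_mul_cancel₀ h2, one_smul]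
    rw [h]
    refine Submodule.smul_mem _ _ (Submodule.sub_mem _ (Submodule.sub_mem _ ?_ ?_) ?_) <;>
      exact Submodule.subset_span ⟨_, rfl⟩

/-- Taking `d = 1` gives `α(a²) = α(a)²`, so the hypothesis is multiplicativity for `x` a square;
squares span `L`. -/
theorem map_mul_of_map_sq_mul {n : ℕ} (hn : Module.finrank k L = n) {lam : Fin n → L →ₐ[k] F}
    (hlam : Function.Injective lam) (α : L →ₗ[k] L) (h1 : α 1 = 1)
    (h : ∀ a d, α (a ^ 2 * d) = α a ^ 2 * α d) (x y : L) : α (x * y) = α x * α y := by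
  have hx : x ∈ Submodule.span k (Set.range fun a : L => a ^ 2) := by
    rw [span_squares_eq_top hn hlam]; trivial
  induction hx using Submodule.span_induction with
  | mem x hx =>
    obtain ⟨a, rfl⟩ := hx
    have := h a 1
    rw [mul_one, h1, mul_one] at this
    exact (h a y).trans (by rw [this])
  | zero => simp
  | add x z _ _ hx hz => rw [add_mul, map_add, hx, hz, map_add, add_mul]
  | smul t x _ hx => rw [smul_mul_assoc, map_smul, hx, map_smul, smul_mul_assoc]

end squares

/-! ### Trace and adjoint identities in a cubic étale algebra. -/

namespace Splitting

variable {k K L F : Type*} [Field k] [CommRing L] [Algebra k L] [CommRing K] [Algebra k K]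
  [Field F] [Algebra k F] [Module.Finite k K] [Module.Finite k L] {σ : K ≃ₐ[k] K}
  (c : Splitting σ L F)

theorem lam_independent {x : Fin 3 → F} (j : Fin 3)
    (h : ∀ a, x j * c.lam j a + x (j + 1) * c.lam (j + 1) a + x (j + 2) * c.lam (j + 2) a = 0)
    (i : Fin 3) : x i = 0 := by
  refine eq_zero_of_sum_algHom_eq_zero c.lam_injective x (fun a => ?_) i
  rw [Fin.sum_univ_three, ← h a]
  fin_cases j
  · rfl
  · exact (add_rotate _ _ _)
  · exact (add_rotate _ _ _).symm

include c in
/-- The trace minus twice the identity is nowhere multiplicative. -/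
theorem eq_zero_of_trace_sub_mul (p : L)
    (h : ∀ a b, (algebraMap k L (Algebra.trace k L (a * b)) - 2 * (a * b)) * p =
      (algebraMap k L (Algebra.trace k L a) - 2 * a) *
        ((algebraMap k L (Algebra.trace k L b) - 2 * b) * p)) : p = 0 := by
  refine c.extL fun j => ?_
  rw [map_zero]
  by_contra hp
  -- Where `p` has a nonzero coordinate it can be cancelled, so `θ`, the coordinate of `a ↦ T(a) -
  -- 2a`, would be multiplicative.
  let θ : L → F := fun a => c.lam (j + 1) a + c.lam (j + 2) a - c.lam j a
  have hθ : ∀ a, c.lam j (algebraMap k L (Algebra.trace k L a) - 2 * a) = θ a := fun a => by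
    rw [map_sub, AlgHom.commutes, c.lam_trace j, map_mul, map_ofNat]
    ring
  have hm : ∀ a b, θ (a * b) = θ a * θ b := fun a b => by
    have := congrArg (c.lam j) (h a b)
    rw [map_mul (c.lam j), map_mul (c.lam j), map_mul (c.lam j), hθ, hθ, hθ, ← mul_assoc] at this
    exact mul_right_cancel₀ hp this
  -- For fixed `b`, the equation `θ(ab) = θ(a) θ(b)` is a linear relation between characters in `a`.
  -- Its coefficients vanish, which makes two distinct characters equal.
  have key : ∀ b, c.lam j b = θ b ∧ c.lam (j + 1) b = θ b := fun b => by
    let x : Fin 3 → F := fun i => if i = j then θ b - c.lam j b else c.lam i b - θ b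
    have h0 : ∀ i, x i = 0 := c.lam_independent j fun a => by
      have h1 : j + 1 ≠ j := by simp
      have h2 : j + 2 ≠ j := by fin_cases j <;> decide
      simp only [x, if_true, if_neg h1, if_neg h2]
      have := hm a b
      simp only [θ, map_mul] at this ⊢
      linear_combination this
    refine ⟨?_, ?_⟩
    · have := h0 j
      simp only [x, if_true] at this
      exact (sub_eq_zero.1 this).symm
    · have := h0 (j + 1)
      have h1 : j + 1 ≠ j := by simp
      simp only [x, if_neg h1] at this
      exact sub_eq_zero.1 this
  have : j = j + 1 := c.lam_injective (AlgHom.ext fun b => (key b).1.trans (key b).2.symm)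
  simp at this

include c in
theorem cubicAdjoint_add_one (a : L) :
    cubicAdjoint k (a + 1) - cubicAdjoint k a - cubicAdjoint k 1 =
      algebraMap k L (Algebra.trace k L a) - a :=
  c.extL fun j => by
    simp only [map_sub, c.lam_cubicAdjoint, map_add, map_one, AlgHom.commutes, c.lam_trace j]
    ring

theorem lam_comp_injective (α : L ≃ₐ[k] L) :
    Function.Injective fun j => (c.lam j).comp α.toAlgHom := fun i j hij =>
  c.lam_injective (AlgHom.ext fun x => by simpa using DFunLike.congr_fun hij (α.symm x))

include c in
theorem cubicAdjoint_algEquiv (α : L ≃ₐ[k] L) (a : L) :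
    cubicAdjoint k (α a) = α (cubicAdjoint k a) := by
  refine c.extL fun j => ?_
  rw [c.lam_cubicAdjoint]
  exact (algHom_cubicAdjoint c.finrank_L (c.lam_comp_injective α) a j).symm

include c in
/-- The linearization of the adjoint is nondegenerate. -/
theorem eq_of_cubicAdjoint_linearization {m n : L}
    (h : ∀ d, cubicAdjoint k (d - m) - cubicAdjoint k (-m) - cubicAdjoint k d =
      cubicAdjoint k (d - n) - cubicAdjoint k (-n) - cubicAdjoint k d) : m = n := by
  refine c.extL fun j => ?_
  -- In the coordinate `j + 2` the linearization is `-(m_j d_{j+1} + m_{j+1} d_j)`, so independence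
  -- of characters in `d` recovers `m_j`.
  let x : Fin 3 → F := fun i => if i = j + 1 then c.lam j m - c.lam j n else
    if i = j then c.lam (j + 1) m - c.lam (j + 1) n else 0
  have hx := c.lam_independent (x := x) j (fun d => ?_) (j + 1)
  · simp only [x, if_true] at hx
    exact sub_eq_zero.1 hx
  · have := congrArg (c.lam (j + 2)) (h d)
    obtain ⟨g1, g2, g3, g4⟩ := fin_three_add j
    have e1 : j ≠ j + 1 := by simp
    have e2 : j + 2 ≠ j + 1 := by fin_cases j <;> decide
    have e3 : j + 2 ≠ j := by fin_cases j <;> decide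
    simp only [map_sub, map_neg, c.lam_cubicAdjoint, g3, g4] at this
    simp only [x, if_true, if_neg e1, if_neg e2, if_neg e3]
    linear_combination -this

end Splitting

/-! ### From isomorphisms to norms. -/

namespace Splitting

variable {k K L F : Type*} [Field k] [CommRing L] [Algebra k L] [CommRing K] [Algebra k K]
  [Field F] [Algebra k F] [Module.Finite k K] [Module.Finite k L] {σ : K ≃ₐ[k] K}
  (c : Splitting σ L F)

include c

/-- An isomorphism preserving `L` restricts to an automorphism of the algebra `L`. -/
theorem exists_algEquiv {u v : Lˣ} {μ ν : Kˣ}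
    (φ : (L × (K ⊗[k] L)) ≃ₗ[k] (L × (K ⊗[k] L))) (h1 : φ TitsProcess.one = TitsProcess.one)
    (hU : ∀ x y, φ (TitsProcess.U σ u μ x y) = TitsProcess.U σ v ν (φ x) (φ y))
    (hL : (LinearMap.range (LinearMap.inl k L (K ⊗[k] L))).map (φ : _ →ₗ[k] _) =
      LinearMap.range (LinearMap.inl k L (K ⊗[k] L))) :
    ∃ α : L ≃ₐ[k] L, ∀ a, φ (a, 0) = (α a, 0) := by
  let α : L →ₗ[k] L :=
    LinearMap.fst k L (K ⊗[k] L) ∘ₗ φ.toLinearMap ∘ₗ LinearMap.inl k L (K ⊗[k] L)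
  have hα : ∀ a, φ (a, 0) = (α a, 0) := fun a => by
    have : φ (a, 0) ∈ LinearMap.range (LinearMap.inl k L (K ⊗[k] L)) := by
      rw [← hL]
      exact ⟨(a, 0), ⟨a, rfl⟩, rfl⟩
    obtain ⟨a', ha'⟩ := this
    change _ = ((φ (a, 0)).1, 0)
    rw [← ha']
    rfl
  have hone : α 1 = 1 := congrArg Prod.fst h1
  have hsq : ∀ a d, α (a ^ 2 * d) = α a ^ 2 * α d := fun a d => by
    have := hU (a, 0) (d, 0)
    rw [c.U_inl, hα, hα, c.U_inl, mul_zero, hα] at this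
    exact congrArg Prod.fst this
  have hbij : Function.Bijective α := by
    refine ⟨fun a b hab => ?_, fun a => ?_⟩
    · have : φ (a, 0) = φ (b, 0) := by rw [hα, hα, hab]
      exact congrArg Prod.fst (φ.injective this)
    · have : (a, (0 : K ⊗[k] L)) ∈ LinearMap.range (LinearMap.inl k L (K ⊗[k] L)) := ⟨a, rfl⟩
      rw [← hL] at this
      obtain ⟨_, ⟨b, rfl⟩, hb⟩ := this
      exact ⟨b, (congrArg Prod.fst (hα b)).symm.trans (congrArg Prod.fst hb)⟩
  exact ⟨AlgEquiv.ofBijective (AlgHom.ofLinearMap α hone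
    (map_mul_of_map_sq_mul c.finrank_L c.lam_injective α hone hsq)) hbij, hα⟩

/-- An isomorphism preserving `L` preserves the complement `E` of `L`. -/
theorem fst_apply_inr {u v : Lˣ} {μ ν : Kˣ}
    (φ : (L × (K ⊗[k] L)) ≃ₗ[k] (L × (K ⊗[k] L)))
    (hU : ∀ x y, φ (TitsProcess.U σ u μ x y) = TitsProcess.U σ v ν (φ x) (φ y))
    (α : L ≃ₐ[k] L) (hα : ∀ a, φ (a, 0) = (α a, 0)) (b : K ⊗[k] L) : (φ (0, b)).1 = 0 := by
  let p : K ⊗[k] L →ₗ[k] L :=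
    LinearMap.fst k L (K ⊗[k] L) ∘ₗ φ.toLinearMap ∘ₗ LinearMap.inr k L (K ⊗[k] L)
  -- `p` is the `L`-component of `φ` on `E`; it must intertwine the action by `a^#` on `E` with the
  -- action by `α(a)²` on `L`.
  have hp : ∀ a b, p ((1 : K) ⊗ₜ cubicAdjoint k a * b) = α a ^ 2 * p b := fun a b => by
    have := hU (a, 0) (0, b)
    rw [c.U_inl, hα, show φ (0, b) = ((φ (0, b)).1, (φ (0, b)).2) from rfl, c.U_inl,
      mul_zero] at this
    exact congrArg Prod.fst this
  -- Linearizing `a^#` at `1` gives `T(a) - a`, and linearizing `α(a)²` gives `2 α(a)`.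
  have hp2 : ∀ a b, p ((1 : K) ⊗ₜ a * b) =
      (algebraMap k L (Algebra.trace k L (α a)) - 2 * α a) * p b := fun a b => by
    have e1 := hp (a + 1) b
    have e2 := hp a b
    have e3 := hp 1 b
    have e4 : p ((1 : K) ⊗ₜ (algebraMap k L (Algebra.trace k L a) - a) * b) =
        2 * α a * p b := by
      rw [← c.cubicAdjoint_add_one, TensorProduct.tmul_sub, TensorProduct.tmul_sub, sub_mul,
        sub_mul, map_sub, map_sub, e1, e2, e3, map_add, map_one]
      ring
    have e5 : (1 : K) ⊗ₜ[k] algebraMap k L (Algebra.trace k L a) * b =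
        Algebra.trace k L a • b := by
      rw [Algebra.algebraMap_eq_smul_one, TensorProduct.tmul_smul, smul_mul_assoc,
        ← Algebra.TensorProduct.one_def, one_mul]
    rw [TensorProduct.tmul_sub, sub_mul, map_sub, e5, map_smul, Algebra.smul_def] at e4
    rw [← Algebra.trace_eq_of_algEquiv α a] at e4
    linear_combination -e4
  refine c.eq_zero_of_trace_sub_mul (p b) fun x y => ?_
  -- Since `L` acts associatively on `E`, the factor `T - 2` would be multiplicative on `p b`.
  have h := hp2 (α.symm (x * y)) b
  rw [map_mul α.symm, ← one_mul (1 : K), ← Algebra.TensorProduct.tmul_mul_tmul, mul_assoc, hp2,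
    hp2, ← map_mul α.symm] at h
  simp only [AlgEquiv.apply_symm_apply] at h
  exact h.symm

/-- Both elements have the same quadratic polynomial, so `κ₀(x)` is one of the two roots `κ₀(y)`,
`κ₁(y)`. -/
theorem eq_or_eq_of_add_eq_of_mul_eq {x y : K}
    (h1 : c.kap 0 x + c.kap 1 x = c.kap 0 y + c.kap 1 y)
    (h2 : c.kap 0 x * c.kap 1 x = c.kap 0 y * c.kap 1 y) : x = y ∨ x = σ y := by
  have h : (c.kap 0 x - c.kap 0 y) * (c.kap 0 x - c.kap 1 y) = 0 := by
    linear_combination c.kap 0 x * h1 - h2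
  rcases mul_eq_zero.1 h with h | h
  · left
    refine c.extK fun i => ?_
    fin_cases i
    · exact sub_eq_zero.1 h
    · change c.kap 1 x = c.kap 1 y
      linear_combination h1 - h
  · right
    refine c.extK fun i => ?_
    rw [c.kap_σ]
    fin_cases i
    · exact sub_eq_zero.1 h
    · change c.kap 1 x = c.kap 0 y
      linear_combination h1 - h

theorem exists_norm_eq_of_algEquiv (α : L ≃ₐ[k] L) (w : K ⊗[k] L) :
    ∃ w' : K ⊗[k] L, α (TitsProcess.normEL w') = TitsProcess.normEL w ∧
      Algebra.norm K w' = Algebra.norm K w := by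
  let w' : K ⊗[k] L := Algebra.TensorProduct.map (AlgHom.id k K) α.symm.toAlgHom w
  have hw' : ∀ (f : K →ₐ[k] F) j, coord f ((c.lam j).comp α.toAlgHom) w' =
      coord f (c.lam j) w := fun f j => by
    have h : (coord f ((c.lam j).comp α.toAlgHom)).comp
        (Algebra.TensorProduct.map (AlgHom.id k K) α.symm.toAlgHom) = coord f (c.lam j) := by
      ext <;> simp
    exact DFunLike.congr_fun h w
  refine ⟨w', c.extL fun j => ?_, c.extK fun i => ?_⟩
  · rw [c.lam_normEL 0, ← hw', ← hw']
    exact algHom_normEL c.finrank_K c.kap_injective ((c.lam j).comp α.toAlgHom) w'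
  · rw [coord_norm c.finrank_L (c.lam_comp_injective α), coord_norm c.finrank_L c.lam_injective]
    simp only [hw']

/-- Here `φ(0, b) = (0, w b)`, and `w 1` is the candidate. Its norm to `L` is `α(u)`; its norm to
`K` has the trace and the norm of `μ`, hence is `μ` or `σ μ`. -/
theorem exists_norm_eq_of_lIsomorphic_one {u : Lˣ} {μ : Kˣ}
    (hadm : TitsProcess.Admissible k u μ) (h : TitsProcess.LIsomorphic σ u μ 1 1) :
    ∃ w : K ⊗[k] L, TitsProcess.normEL w = u ∧ Algebra.norm K w = μ := by
  obtain ⟨φ, h1, hU, hL⟩ := h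
  obtain ⟨α, hα⟩ := c.exists_algEquiv φ h1 hU hL
  have hp := c.fst_apply_inr φ hU α hα
  let w : K ⊗[k] L →ₗ[k] K ⊗[k] L :=
    LinearMap.snd k L (K ⊗[k] L) ∘ₗ φ.toLinearMap ∘ₗ LinearMap.inr k L (K ⊗[k] L)
  have hw : ∀ b, φ (0, b) = (0, w b) := fun b => Prod.ext (hp b) rfl
  have hUr : ∀ b d, _ := fun b d => hU (0, b) (d, 0)
  simp only [c.U_inr, hα, hw] at hUr
  have hφ : ∀ a b, φ (a, b) = (α a, w b) := fun a b => by
    rw [show (a, b) = (a, 0) + (0, b) by simp, map_add, hα, hw]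
    simp
  simp only [hφ] at hUr
  have hn : ∀ b, α (u * TitsProcess.normEL b) = TitsProcess.normEL (w b) := fun b => by
    refine c.eq_of_cubicAdjoint_linearization fun d => ?_
    have := congrArg Prod.fst (hUr b (α.symm d))
    simp only [map_neg, map_sub, ← c.cubicAdjoint_algEquiv, AlgEquiv.apply_symm_apply,
      Units.val_one, one_mul] at this
    simpa using this
  have hm : ∀ b, w (TitsProcess.adjoint σ u μ (0, b)).2 =
      (TitsProcess.adjoint σ 1 1 (0, w b)).2 := fun b => by
    have := congrArg Prod.snd (hUr b 1)
    simpa only [map_one, ← Algebra.TensorProduct.one_def, one_mul] using this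
  -- `e` is the `E`-component of `(0, 1)^#`, so `w` sends it to `τ(w 1)^#`.
  set e : K ⊗[k] L := σ (μ : K) ⊗ₜ[k] ((u⁻¹ : Lˣ) : L) with he
  have hu : TitsProcess.normEL (w 1) = α u := by
    rw [← hn]
    congr 1
    exact c.extL fun j => by rw [map_mul, c.lam_normEL 0]; simp
  have hwe : w e = cubicAdjoint K (UnitaryTorus.tau σ L (w 1)) := by
    have h := hm 1
    have hτ : cubicAdjoint K (1 : K ⊗[k] L) = 1 :=
      c.extE fun i j => by rw [c.ev_cubicAdjoint]; simp
    simpa [TitsProcess.adjoint, hτ, ← he, ← Algebra.TensorProduct.one_def] using h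
  -- This is `T_{K/k}(μ)`, written through norms so that `norm_eqK` computes it.
  set t : k := Algebra.norm k ((μ : K) + 1) - Algebra.norm k (μ : K) - 1 with ht
  have htF : algebraMap k F t = c.kap 0 (μ : K) + c.kap 1 (μ : K) := by
    simp only [ht, map_sub, c.norm_eqK _ 0, map_add, map_one]
    simp only [zero_add]
    ring
  have hte : u * TitsProcess.normEL (1 + e) - u * TitsProcess.normEL (1 : K ⊗[k] L) -
      u * TitsProcess.normEL e = algebraMap k L t := by
    refine c.extL fun j => ?_
    have h1 := c.lam_inv j u
    rw [AlgHom.commutes, htF]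
    simp only [map_sub, map_mul, c.lam_normEL 0, map_add, map_one, he, c.ev_tmul, c.kap_σ,
      fin_two_add]
    simp only [zero_add]
    linear_combination (c.kap 1 (μ : K) + c.kap 0 (μ : K)) * h1
  -- The polarization of `u N_{E/L}` at `(1, e)` is `T(μ)`. Transported by `hn` it becomes the
  -- polarization of `N_{E/L}` at `(w 1, τ(w 1)^#)`, which is the trace of `N_{E/K}(w 1)`.
  have hadd : c.kap 0 (Algebra.norm K (w 1)) + c.kap 1 (Algebra.norm K (w 1)) =
      c.kap 0 (μ : K) + c.kap 1 (μ : K) := by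
    have h := congrArg (fun x => c.lam 0 (α x)) hte
    simp only [map_sub, hn, map_add, hwe, AlgEquiv.commutes, AlgHom.commutes, htF] at h
    simp only [map_add, c.lam_normEL 0, c.ev_cubicAdjoint, c.ev_tau, fin_two_add] at h
    rw [← h, c.kap_norm _ 0, c.kap_norm _ 0]
    simp only [zero_add]
    ring
  -- Both ways down from `E` to `k` give `N_{L/k}(α u) = N_{L/k}(u)`, which is `N_{K/k}(μ)` by
  -- admissibility.
  have hmul : c.kap 0 (Algebra.norm K (w 1)) * c.kap 1 (Algebra.norm K (w 1)) =
      c.kap 0 (μ : K) * c.kap 1 (μ : K) := by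
    have h := hadm
    rw [TitsProcess.Admissible, ← Algebra.norm_eq_of_algEquiv α, ← hu] at h
    have h2 := congrArg (algebraMap k F) h
    rw [c.norm_eqK _ 0, c.norm_eq _ 0, c.lam_normEL 0, c.lam_normEL 0, c.lam_normEL 0] at h2
    simp only [zero_add] at h2
    rw [← h2, c.kap_norm _ 0, c.kap_norm _ 0]
    simp only [zero_add]
    ring
  obtain ⟨w', hw1, hw2⟩ := c.exists_norm_eq_of_algEquiv α (w 1)
  rw [hu] at hw1
  have hw1' := α.injective hw1
  rcases c.eq_or_eq_of_add_eq_of_mul_eq hadd hmul with h | h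
  · exact ⟨w', hw1', hw2.trans h⟩
  -- Applying `τ` conjugates the norm to `K` and keeps the norm to `L`.
  · refine ⟨UnitaryTorus.tau σ L w', ?_, c.extK fun i => ?_⟩
    · rw [← hw1']
      refine c.extL fun j => ?_
      rw [c.lam_normEL 0, c.lam_normEL 0, c.ev_tau, c.ev_tau, fin_two_add, mul_comm]
    · have h3 := congrArg (c.kap (i + 1)) (hw2.trans h)
      rw [c.kap_σ, fin_two_add, c.kap_norm _ 0] at h3
      rw [← h3, c.kap_norm _ 0, c.ev_tau, c.ev_tau, c.ev_tau]

end Splitting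

/-! ### Hilbert 90 for split algebras. -/

section hilbert90

/-- A twisted action on a split algebra has an invariant unit as soon as its invariants do not
all vanish at any coordinate. -/
theorem exists_unit_invariant {R F X Γ : Type*} [CommRing R] [Field F] [Fintype X]
    (χ : X → R →+* F) (hinj : ∀ r, (∀ x, χ x r = 0) → r = 0)
    (hsurj : ∀ z : X → F, ∃ r, ∀ x, χ x r = z x) (ρ : Γ → R →+* R) (f : Γ → Rˣ)
    (h : ∀ x, ∃ v, (∀ γ, f γ * ρ γ v = v) ∧ χ x v ≠ 0) : ∃ v : Rˣ, ∀ γ, f γ * ρ γ v = v := by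
  classical
  -- Choose an invariant with the fewest vanishing coordinates. This avoids a generic choice, so `k`
  -- may be finite.
  let S : Set ℕ := {n | ∃ v, (∀ γ, f γ * ρ γ v = v) ∧
    (Finset.univ.filter fun x => χ x v = 0).card = n}
  have hS : S.Nonempty := ⟨_, 0, by simp, rfl⟩
  obtain ⟨v, hv, hcard⟩ := Nat.sInf_mem hS
  have hne : ∀ x, χ x v ≠ 0 := by
    intro x hx
    obtain ⟨v', hv', hx'⟩ := h x
    obtain ⟨y, hy⟩ := hsurj fun x => (χ x v)⁻¹
    have hyv : y * v * v = v := by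
      refine sub_eq_zero.1 (hinj _ fun x => ?_)
      rw [map_sub, map_mul, map_mul, hy]
      by_cases h0 : χ x v = 0
      · simp [h0]
      · rw [inv_mul_cancel₀ h0, one_mul, sub_self]
    -- `y * v` is the idempotent supported where `v` is nonzero; it is fixed because `v` and `ρ γ v`
    -- differ by a unit.
    have hρ : ∀ γ, ρ γ (y * v) = y * v := by
      intro γ
      have h1 : ρ γ (y * v) * v = v := by
        calc ρ γ (y * v) * v = f γ * ρ γ (y * v * v) := by
              rw [map_mul (ρ γ) (y * v), mul_left_comm, hv]
          _ = v := by rw [hyv, hv]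
      have h2 : (ρ γ y * ((f γ)⁻¹ : Rˣ)) * v = ρ γ (y * v) := by
        conv_lhs => rw [← hv γ]
        rw [map_mul, mul_assoc, Units.inv_mul_cancel_left]
      calc ρ γ (y * v) = (ρ γ y * ((f γ)⁻¹ : Rˣ)) * (y * v * v) := by rw [hyv, h2]
        _ = y * v * ρ γ (y * v) := by rw [← h2]; ring
        _ = y * (ρ γ (y * v) * v) := by ring
        _ = y * v := by rw [h1]
    -- Adding the part of `v'` off the support of `v` keeps the invariance and the nonzero
    -- coordinates, and repairs the coordinate `x`.
    have hlt : (Finset.univ.filter fun x => χ x (v + (1 - y * v) * v') = 0).card <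
        (Finset.univ.filter fun x => χ x v = 0).card := by
      refine Finset.card_lt_card ((Finset.ssubset_iff_of_subset ?_).2 ⟨x, by simpa, ?_⟩)
      · intro z
        simp only [Finset.mem_filter, Finset.mem_univ, true_and]
        intro hz
        by_contra h0
        apply h0
        simpa [hy, inv_mul_cancel₀ h0] using hz
      · simpa [hx] using hx'
    refine absurd (Nat.sInf_le (s := S) ⟨v + (1 - y * v) * v', fun γ => ?_, rfl⟩) ?_
    · rw [map_add, map_mul, map_sub, map_one, hρ, mul_add, hv]
      conv_rhs => rw [← hv' γ]
      ring
    · rw [← hcard]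
      exact not_le.2 hlt
  obtain ⟨y, hy⟩ := hsurj fun x => (χ x v)⁻¹
  have hyv : v * y = 1 := by
    refine sub_eq_zero.1 (hinj _ fun x => ?_)
    rw [map_sub, map_mul, hy, mul_inv_cancel₀ (hne x), map_one, sub_self]
  exact ⟨Units.mkOfMulEqOne v y hyv, hv⟩

variable {k F R X : Type*} [Field k] [Field F] [Algebra k F] [CommRing R]

/-- Nonvanishing of the averages of the scalars under a twisted action. -/
theorem exists_invariant_ne_zero [IsGalois k F] (i : F →+* R)
    (ρ : (F ≃ₐ[k] F) → R →+* R) (hρ1 : ∀ r, ρ 1 r = r) (hρ : ∀ γ a, ρ γ (i a) = i (γ a))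
    (f : (F ≃ₐ[k] F) → Rˣ) (hf : IsLocallyConstant f)
    (hcoc : ∀ γ δ, (f (γ * δ) : R) = f γ * ρ γ (f δ)) (χ : R →+* F) (hχ : ∀ a, χ (i a) = a) :
    ∃ v, (∀ γ, f γ * ρ γ v = v) ∧ χ v ≠ 0 := by
  have hf1 : f 1 = 1 := by
    have h1 := hcoc 1 1
    rw [mul_one, hρ1] at h1
    exact Units.ext ((f 1).isUnit.mul_left_cancel (h1.symm.trans (mul_one _).symm))
  have hnhds : f ⁻¹' {1} ∈ nhds (1 : F ≃ₐ[k] F) :=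
    (hf.isOpen_fiber 1).mem_nhds hf1
  -- Continuity makes `f` factor through a finite Galois group `Gal(M/k)`; `s` will lift its
  -- elements to `F`.
  obtain ⟨M, hM, hN, hMf⟩ := (krullTopology_mem_nhds_one_iff_of_normal k F _).1 hnhds
  have : IsGalois k M := IsGalois.mk
  have hfM : ∀ γ δ : F ≃ₐ[k] F,
      AlgEquiv.restrictNormalHom M γ = AlgEquiv.restrictNormalHom M δ → f γ = f δ := by
    intro γ δ h
    have h1 : γ⁻¹ * δ ∈ M.fixingSubgroup := by
      rw [← IntermediateField.restrictNormalHom_ker, MonoidHom.mem_ker, map_mul, map_inv, h,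
        inv_mul_cancel]
    have h2 : f (γ⁻¹ * δ) = 1 := hMf h1
    have h3 := hcoc γ (γ⁻¹ * δ)
    rw [h2, mul_inv_cancel_left, Units.val_one, map_one, mul_one] at h3
    exact (Units.ext h3).symm
  have hs : Function.Surjective (AlgEquiv.restrictNormalHom (F := k) (K₁ := F) M) :=
    AlgEquiv.restrictNormalHom_surjective F
  choose s hs using hs
  have hsM : ∀ (γ : F ≃ₐ[k] F) (a : M), γ a = (AlgEquiv.restrictNormalHom M γ a : F) :=
    fun γ a => (AlgEquiv.restrictNormal_commutes γ M a).symm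
  let v : M → R := fun a => ∑ g : M ≃ₐ[k] M, f (s g) * i (g a : F)
  have hv : ∀ a γ, f γ * ρ γ (v a) = v a := by
    intro a γ
    simp only [v, map_sum, map_mul, Finset.mul_sum]
    conv_rhs => rw [← Equiv.sum_comp (Equiv.mulLeft (AlgEquiv.restrictNormalHom M γ))]
    refine Finset.sum_congr rfl fun g _ => ?_
    have h1 : f (s (AlgEquiv.restrictNormalHom M γ * g)) = f (γ * s g) :=
      hfM _ _ (by rw [hs, map_mul, hs])
    rw [Equiv.coe_mulLeft, h1, hcoc, hρ, hsM, mul_assoc]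
    rfl
  by_contra! hcon
  have h0 : ∀ a, χ (v a) = 0 := fun a => hcon _ (hv a)
  have hinj : Function.Injective fun g : M ≃ₐ[k] M => M.val.comp g.toAlgHom := fun g h hgh =>
    AlgEquiv.ext fun a => Subtype.ext (DFunLike.congr_fun hgh a)
  -- If all averages `v a` died under `χ`, the automorphisms of `M` would satisfy a linear relation
  -- with nonzero coefficients.
  have h1 := eq_zero_of_sum_algHom_eq_zero hinj (fun g => χ (f (s g))) (fun a => by
    rw [← h0 a]
    simp only [v, map_sum, map_mul, hχ]
    rfl) 1
  exact ((f (s 1)).isUnit.map χ).ne_zero h1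

end hilbert90

/-! ### Galois descent. -/

section descent

variable {k A₀ A B : Type*} [Field k] [CommRing A₀] [Algebra k A₀] [CommRing A] [Algebra k A]
  [CommRing B] [Algebra k B] [Module.Finite k B]

/-- The group acts only on the coefficients along a `k`-basis of `B`, so invariance is tested on
each coefficient. -/
theorem mem_range_map_of_fixed {Γ : Type*} (s : Γ → A ≃ₐ[k] A) (ι : A₀ →ₐ[k] A)
    (h : ∀ a, (∀ γ, s γ a = a) → a ∈ Set.range ι) (x : A ⊗[k] B)
    (hx : ∀ γ, Algebra.TensorProduct.congr (s γ) (AlgEquiv.refl : B ≃ₐ[k] B) x = x) :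
    x ∈ Set.range (Algebra.TensorProduct.map ι (AlgHom.id k B)) := by
  let b := Module.finBasis k B
  let bA := Algebra.TensorProduct.basis A b
  have hsum : ∀ x, x = ∑ l, (bA.repr x l) ⊗ₜ[k] b l := fun x => by
    conv_lhs => rw [← bA.sum_repr x]
    refine Finset.sum_congr rfl fun l _ => ?_
    simp [bA, TensorProduct.smul_tmul']
  have hl : ∀ l, bA.repr x l ∈ Set.range ι := fun l => h _ fun γ => by
    have h1 := hx γ
    rw [hsum x, map_sum] at h1
    have h2 := congrArg (fun y => bA.repr y l) h1
    simp only [map_sum, Finsupp.finsetSum_apply] at h2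
    have h3 : ∀ (a : A) (m), bA.repr (a ⊗ₜ[k] b m) l = if m = l then a else 0 := fun a m => by
      simp [bA, Algebra.TensorProduct.basis_repr_tmul, Finsupp.single_apply]
    simpa [h3] using h2
  choose y hy using hl
  refine ⟨∑ l, y l ⊗ₜ b l, ?_⟩
  conv_rhs => rw [hsum x]
  simp [hy]

end descent

namespace Splitting

variable {k K L F : Type*} [Field k] [CommRing L] [Algebra k L] [CommRing K] [Algebra k K]
  [Field F] [Algebra k F] [Module.Finite k K] [Module.Finite k L] {σ : K ≃ₐ[k] K}
  (c : Splitting σ L F)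

/-- The coordinates of `F ⊗ K`. -/
noncomputable abbrev kapS (i : Fin 2) : F ⊗[k] K →ₐ[k] F := coord (AlgHom.id k F) (c.kap i)

/-- The coordinates of `F ⊗ K ⊗ L`. -/
noncomputable abbrev evS (i : Fin 2) (j : Fin 3) : (F ⊗[k] K) ⊗[k] L →ₐ[k] F :=
  coord (c.kapS i) (c.lam j)

theorem extKS {x y : F ⊗[k] K} (h : ∀ i, c.kapS i x = c.kapS i y) : x = y :=
  coord_ext (I := Unit) (f := fun _ => AlgHom.id k F) c.finrank_K c.kap_injective
    (fun _ ha => ha ()) fun _ => h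

theorem surjKS (z : Fin 2 → F) : ∃ x, ∀ i, c.kapS i x = z i := by
  obtain ⟨x, hx⟩ := coord_surjective (I := Unit) (f := fun _ => AlgHom.id k F)
    c.finrank_K c.kap_injective (fun z => ⟨z (), fun _ => rfl⟩) fun _ => z
  exact ⟨x, hx ()⟩

theorem extS {x y : (F ⊗[k] K) ⊗[k] L} (h : ∀ i j, c.evS i j x = c.evS i j y) : x = y :=
  coord_ext c.finrank_L c.lam_injective
    (fun _ ha => c.extKS fun i => (ha i).trans (map_zero _).symm) h

theorem surjS (z : Fin 2 → Fin 3 → F) : ∃ x, ∀ i j, c.evS i j x = z i j :=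
  coord_surjective c.finrank_L c.lam_injective c.surjKS z

theorem evS_tau (i : Fin 2) (j : Fin 3) (x : (F ⊗[k] K) ⊗[k] L) :
    c.evS i j (UnitaryTorus.tau (Algebra.TensorProduct.congr AlgEquiv.refl σ) L x) =
      c.evS (i + 1) j x := by
  have h : (c.kapS i).comp (Algebra.TensorProduct.congr
      (AlgEquiv.refl : F ≃ₐ[k] F) σ).toAlgHom = c.kapS (i + 1) := by
    rw [kapS, kapS, ← c.kap_comp]
    ext <;> simp
  rw [evS, coord_tau, h]

theorem kapS_norm (i : Fin 2) (j : Fin 3) (x : (F ⊗[k] K) ⊗[k] L) :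
    c.kapS i (Algebra.norm (F ⊗[k] K) x) =
      c.evS i j x * c.evS i (j + 1) x * c.evS i (j + 2) x := by
  rw [coord_norm c.finrank_L c.lam_injective, Fin.prod_univ_three]
  fin_cases j
  · rfl
  · exact (mul_rotate _ _ _)
  · exact (mul_rotate _ _ _).symm

variable (k K L F) in
/-- The inclusion of `K ⊗ L` in `F ⊗ K ⊗ L`. -/
noncomputable def incl : K ⊗[k] L →ₐ[k] (F ⊗[k] K) ⊗[k] L :=
  Algebra.TensorProduct.map Algebra.TensorProduct.includeRight (AlgHom.id k L)

theorem evS_incl (i : Fin 2) (j : Fin 3) (x : K ⊗[k] L) :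
    c.evS i j (incl k K L F x) = c.ev i j x := by
  have h : (c.evS i j).comp (incl k K L F) = c.ev i j := by
    ext <;> simp [incl]
  exact DFunLike.congr_fun h x

include c in
theorem incl_injective : Function.Injective (incl k K L F) := fun x y h => c.extE fun i j => by
  rw [← c.evS_incl, h, c.evS_incl]

theorem gal_incl (γ : F ≃ₐ[k] F) (x : K ⊗[k] L) :
    UnitaryTorus.gal K L γ (incl k K L F x) = incl k K L F x := by
  have h : (UnitaryTorus.gal K L γ).toAlgHom.comp (incl k K L F) = incl k K L F := by
    ext <;> simp [incl, UnitaryTorus.gal, Algebra.TensorProduct.one_def]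
  exact DFunLike.congr_fun h x

theorem mem_range_includeRight [IsGalois k F] (x : F ⊗[k] K)
    (hx : ∀ γ : F ≃ₐ[k] F, Algebra.TensorProduct.congr γ AlgEquiv.refl x = x) :
    x ∈ Set.range (Algebra.TensorProduct.includeRight : K →ₐ[k] F ⊗[k] K) := by
  obtain ⟨y, rfl⟩ := mem_range_map_of_fixed (fun γ : F ≃ₐ[k] F => γ) (Algebra.ofId k F)
    (fun a ha => (InfiniteGalois.mem_range_algebraMap_iff_fixed a).2 ha) x hx
  refine ⟨Algebra.TensorProduct.lid k K y, ?_⟩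
  have h : (Algebra.TensorProduct.includeRight : K →ₐ[k] F ⊗[k] K).comp
      (Algebra.TensorProduct.lid k K).toAlgHom =
      Algebra.TensorProduct.map (Algebra.ofId k F) (AlgHom.id k K) := by
    ext; simp
  exact DFunLike.congr_fun h y

theorem mem_range_incl [IsGalois k F] (x : (F ⊗[k] K) ⊗[k] L)
    (hx : ∀ γ : F ≃ₐ[k] F, UnitaryTorus.gal K L γ x = x) : x ∈ Set.range (incl k K L F) :=
  mem_range_map_of_fixed (A := F ⊗[k] K) (A₀ := K) (B := L)
    (fun γ : F ≃ₐ[k] F => Algebra.TensorProduct.congr γ (AlgEquiv.refl : K ≃ₐ[k] K))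
    (Algebra.TensorProduct.includeRight : K →ₐ[k] F ⊗[k] K)
    (fun a ha => mem_range_includeRight a ha) x hx

/-- A tensor involves finitely many scalars, each with open stabilizer. This gives the continuity of
`γ ↦ g⁻¹ γ(g)`. -/
theorem eventually_gal_eq [Algebra.IsIntegral k F] (x : (F ⊗[k] K) ⊗[k] L) :
    ∀ᶠ γ in nhds (1 : F ≃ₐ[k] F), UnitaryTorus.gal K L γ x = x := by
  induction x with
  | zero => simp
  | add x y hx hy =>
    filter_upwards [hx, hy] with γ h1 h2
    rw [map_add, h1, h2]
  | tmul a l =>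
    induction a with
    | zero => simp
    | add x y hx hy =>
      filter_upwards [hx, hy] with γ h1 h2
      rw [TensorProduct.add_tmul, map_add, h1, h2]
    | tmul s a =>
      filter_upwards [(stabilizer_isOpen_of_isIntegral (K := k) s).mem_nhds (one_mem _)]
        with γ hγ
      have : γ s = s := hγ
      simp [UnitaryTorus.gal, this]

include c in
/-- Hilbert 90 for the units of `F ⊗ K ⊗ L`. -/
theorem exists_coboundary [IsGalois k F] (f : (F ≃ₐ[k] F) → ((F ⊗[k] K) ⊗[k] L)ˣ)
    (hf : IsLocallyConstant f)
    (hcoc : ∀ γ δ, (f (γ * δ) : (F ⊗[k] K) ⊗[k] L) = f γ * UnitaryTorus.gal K L γ (f δ)) :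
    ∃ v : ((F ⊗[k] K) ⊗[k] L)ˣ,
      ∀ γ, (f γ : (F ⊗[k] K) ⊗[k] L) * UnitaryTorus.gal K L γ v = v := by
  refine exists_unit_invariant
    (fun x : Fin 2 × Fin 3 => (c.evS x.1 x.2 : (F ⊗[k] K) ⊗[k] L →+* F))
    (fun r hr => c.extS fun i j => (hr (i, j)).trans (map_zero _).symm)
    (fun z => ?_) (fun γ => (UnitaryTorus.gal K L γ : (F ⊗[k] K) ⊗[k] L →+* _)) f fun x => ?_
  · obtain ⟨r, hr⟩ := c.surjS fun i j => z (i, j)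
    exact ⟨r, fun x => hr x.1 x.2⟩
  · refine exists_invariant_ne_zero
      ((Algebra.TensorProduct.includeLeft.comp Algebra.TensorProduct.includeLeft :
        F →ₐ[k] (F ⊗[k] K) ⊗[k] L) : F →+* (F ⊗[k] K) ⊗[k] L)
      (fun γ => (UnitaryTorus.gal K L γ : (F ⊗[k] K) ⊗[k] L →+* _))
      (UnitaryTorus.gal_one K L) (fun γ a => ?_) f hf hcoc _ fun a => ?_
    · simp [UnitaryTorus.gal]
    · simp

end Splitting

/-! ### Cocycles in `T` and admissible pairs. -/

namespace Splitting

variable {k K L F : Type*} [Field k] [CommRing L] [Algebra k L] [CommRing K] [Algebra k K]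
  [Field F] [Algebra k F] [Module.Finite k K] [Module.Finite k L] {σ : K ≃ₐ[k] K}
  (c : Splitting σ L F)

/-- The involution of `F ⊗ K ⊗ L`. -/
noncomputable abbrev tauS (σ : K ≃ₐ[k] K) (L F : Type*) [CommRing L] [Algebra k L] [Field F]
    [Algebra k F] : (F ⊗[k] K) ⊗[k] L ≃ₐ[k] (F ⊗[k] K) ⊗[k] L :=
  UnitaryTorus.tau (Algebra.TensorProduct.congr (AlgEquiv.refl : F ≃ₐ[k] F) σ) L

theorem gal_tauS (γ : F ≃ₐ[k] F) (x : (F ⊗[k] K) ⊗[k] L) :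
    UnitaryTorus.gal K L γ (tauS σ L F x) = tauS σ L F (UnitaryTorus.gal K L γ x) := by
  have h : (UnitaryTorus.gal K L γ).toAlgHom.comp (tauS σ L F).toAlgHom =
      (tauS σ L F).toAlgHom.comp (UnitaryTorus.gal K L γ).toAlgHom := by
    ext <;> simp [tauS, UnitaryTorus.gal, UnitaryTorus.tau]
  exact DFunLike.congr_fun h x

theorem norm_gal (γ : F ≃ₐ[k] F) (x : (F ⊗[k] K) ⊗[k] L) :
    Algebra.norm (F ⊗[k] K) (UnitaryTorus.gal K L γ x) =
      Algebra.TensorProduct.congr γ (AlgEquiv.refl : K ≃ₐ[k] K)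
        (Algebra.norm (F ⊗[k] K) x) := by
  have h := Algebra.norm_eq_of_equiv_equiv
    (Algebra.TensorProduct.congr γ (AlgEquiv.refl : K ≃ₐ[k] K)).toRingEquiv
    (UnitaryTorus.gal K L γ).toRingEquiv
    (by
      refine RingHom.ext fun y => ?_
      change (Algebra.TensorProduct.congr γ (AlgEquiv.refl : K ≃ₐ[k] K) y) ⊗ₜ[k]
        (1 : L) = UnitaryTorus.gal K L γ (y ⊗ₜ[k] (1 : L))
      simp [UnitaryTorus.gal]) x
  have h' := congrArg
    (Algebra.TensorProduct.congr γ (AlgEquiv.refl : K ≃ₐ[k] K)).toRingEquiv h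
  rw [RingEquiv.apply_symm_apply] at h'
  exact h'.symm

theorem tauS_incl (x : K ⊗[k] L) :
    tauS σ L F (incl k K L F x) = incl k K L F (UnitaryTorus.tau σ L x) := by
  have h : (tauS σ L F).toAlgHom.comp (incl k K L F) =
      (incl k K L F).comp (UnitaryTorus.tau σ L).toAlgHom := by
    ext <;> simp [incl, tauS, UnitaryTorus.tau]
  exact DFunLike.congr_fun h x

include c

theorem norm_incl (x : K ⊗[k] L) :
    Algebra.norm (F ⊗[k] K) (incl k K L F x) = (1 : F) ⊗ₜ[k] Algebra.norm K x :=
  c.extKS fun i => by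
    rw [c.kapS_norm i 0]
    simp only [c.evS_incl]
    rw [← c.kap_norm]
    simp

theorem incl_mul_tauS (x : K ⊗[k] L) :
    incl k K L F x * tauS σ L F (incl k K L F x) =
      incl k K L F ((1 : K) ⊗ₜ TitsProcess.normEL x) := by
  rw [tauS_incl, ← map_mul, c.one_tmul_normEL]

/-- If `1` and `a` were independent they would span `K`, and `σ` would be the identity, although it
swaps two distinct characters. -/
theorem mem_range_algebraMap_of_fixed (a : K) (ha : σ a = a) :
    a ∈ Set.range (algebraMap k K) := by
  have : Nontrivial K := (c.kap 0 : K →+* F).domain_nontrivial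
  by_cases hli : LinearIndependent k ![1, a]
  · exfalso
    have hspan := hli.span_eq_top_of_card_eq_finrank' (by simp [c.finrank_K])
    have h : σ.toLinearMap = LinearMap.id := by
      refine LinearMap.ext_on hspan ?_
      rintro _ ⟨i, rfl⟩
      fin_cases i
      · simp
      · simpa using ha
    have h01 : c.kap 0 = c.kap (0 + 1) := by
      rw [← c.kap_comp]
      exact AlgHom.ext fun x => congrArg (c.kap 0) (LinearMap.congr_fun h x).symm
    exact absurd (c.kap_injective h01) (by decide)
  · rw [LinearIndependent.pair_iff] at hli
    push Not at hli
    obtain ⟨s, t, hst, hne⟩ := hli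
    have ht : t ≠ 0 := by
      rintro rfl
      rw [zero_smul, add_zero, smul_eq_zero] at hst
      exact hne (hst.resolve_right one_ne_zero) rfl
    refine ⟨-(t⁻¹ * s), ?_⟩
    have h1 : t • a = -(s • (1 : K)) := by linear_combination hst
    rw [Algebra.algebraMap_eq_smul_one, neg_smul, mul_smul, ← smul_neg, ← h1, smul_smul,
      inv_mul_cancel₀ ht, one_smul]

theorem exists_eq_one_tmul (x : K ⊗[k] L) (hx : UnitaryTorus.tau σ L x = x) :
    ∃ u : L, (1 : K) ⊗ₜ[k] u = x := by
  obtain ⟨y, rfl⟩ := mem_range_map_of_fixed (fun _ : Unit => σ) (Algebra.ofId k K)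
    (fun a ha => c.mem_range_algebraMap_of_fixed a (ha ())) x fun _ => hx
  refine ⟨Algebra.TensorProduct.lid k L y, ?_⟩
  have h : (Algebra.TensorProduct.includeRight : L →ₐ[k] K ⊗[k] L).comp
      (Algebra.TensorProduct.lid k L).toAlgHom =
      Algebra.TensorProduct.map (Algebra.ofId k K) (AlgHom.id k L) := by
    ext; simp
  exact DFunLike.congr_fun h y

theorem isUnit_of_lam_ne_zero {u : L} (h : ∀ j, c.lam j u ≠ 0) : IsUnit u := by
  have h1 : u * cubicAdjoint k u = algebraMap k L (Algebra.norm k u) := c.extL fun j => by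
    rw [map_mul, c.lam_cubicAdjoint, AlgHom.commutes, c.norm_eq _ j, mul_assoc]
  refine isUnit_of_mul_isUnit_left (y := cubicAdjoint k u) ?_
  rw [h1]
  refine (isUnit_iff_ne_zero.2 fun h0 => ?_).map _
  have h2 := c.norm_eq u 0
  rw [h0, map_zero] at h2
  exact mul_ne_zero (mul_ne_zero (h _) (h _)) (h _) h2.symm

theorem isUnit_of_kap_ne_zero {μ : K} (h : ∀ i, c.kap i μ ≠ 0) : IsUnit μ := by
  have h1 : μ * σ μ = algebraMap k K (Algebra.norm k μ) := c.extK fun i => by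
    rw [map_mul, c.kap_σ, AlgHom.commutes, c.norm_eqK _ i]
  refine isUnit_of_mul_isUnit_left (y := σ μ) ?_
  rw [h1]
  refine (isUnit_iff_ne_zero.2 fun h0 => ?_).map _
  have h2 := c.norm_eqK μ 0
  rw [h0, map_zero] at h2
  exact mul_ne_zero (h _) (h _) h2.symm

/-- An element of `F ⊗ E` with invariant norms lies over an admissible pair. -/
theorem exists_admissible [IsGalois k F] (v : ((F ⊗[k] K) ⊗[k] L)ˣ)
    (h1 : ∀ γ : F ≃ₐ[k] F, UnitaryTorus.gal K L γ (v * tauS σ L F v) = v * tauS σ L F v)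
    (h2 : ∀ γ : F ≃ₐ[k] F, Algebra.TensorProduct.congr γ (AlgEquiv.refl : K ≃ₐ[k] K)
      (Algebra.norm (F ⊗[k] K) (v : (F ⊗[k] K) ⊗[k] L)) =
        Algebra.norm (F ⊗[k] K) (v : (F ⊗[k] K) ⊗[k] L)) :
    ∃ (u : Lˣ) (μ : Kˣ), TitsProcess.Admissible k u μ ∧
      incl k K L F ((1 : K) ⊗ₜ (u : L)) = v * tauS σ L F v ∧
      (1 : F) ⊗ₜ[k] (μ : K) = Algebra.norm (F ⊗[k] K) (v : (F ⊗[k] K) ⊗[k] L) := by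
  have hv : ∀ i j, c.evS i j v ≠ 0 := fun i j => (v.isUnit.map (c.evS i j)).ne_zero
  obtain ⟨x, hx⟩ := mem_range_incl _ h1
  obtain ⟨u, rfl⟩ := c.exists_eq_one_tmul x (c.incl_injective (by
    rw [← tauS_incl, hx]
    refine c.extS fun i j => ?_
    rw [c.evS_tau, map_mul, map_mul, c.evS_tau, c.evS_tau, fin_two_add, mul_comm]))
  obtain ⟨μ, hμ⟩ := mem_range_includeRight _ h2
  have hu' : ∀ j, c.lam j u = c.evS 0 j v * c.evS 1 j v := fun j => by
    have := congrArg (c.evS 0 j) hx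
    rw [c.evS_incl, c.ev_tmul, map_one, one_mul, map_mul, c.evS_tau] at this
    exact this
  have hμ' : ∀ i, c.kap i μ = c.evS i 0 v * c.evS i 1 v * c.evS i 2 v := fun i => by
    have := congrArg (c.kapS i) hμ
    rw [c.kapS_norm i 0] at this
    simpa using this
  obtain ⟨u, rfl⟩ := c.isUnit_of_lam_ne_zero (u := u) fun j => by
    rw [hu']
    exact mul_ne_zero (hv _ _) (hv _ _)
  obtain ⟨μ, rfl⟩ := c.isUnit_of_kap_ne_zero (μ := μ) fun i => by
    rw [hμ']
    exact mul_ne_zero (mul_ne_zero (hv _ _) (hv _ _)) (hv _ _)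
  -- Both norms to `k` are the product of all six coordinates of `v`.
  refine ⟨u, μ, (algebraMap k F).injective ?_, hx, hμ⟩
  rw [c.norm_eq _ 0, c.norm_eqK _ 0, hu', hu', hu', hμ', hμ']
  simp only [zero_add]
  ring

/-- Over `F` every admissible pair is a pair of norms. -/
theorem exists_norms_eq {u : Lˣ} {μ : Kˣ} (h : TitsProcess.Admissible k u μ) :
    ∃ g : ((F ⊗[k] K) ⊗[k] L)ˣ,
      incl k K L F ((1 : K) ⊗ₜ (u : L)) = g * tauS σ L F g ∧
      (1 : F) ⊗ₜ[k] (μ : K) = Algebra.norm (F ⊗[k] K) (g : (F ⊗[k] K) ⊗[k] L) := by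
  have hμ0 : c.kap 0 (μ : K) ≠ 0 := (μ.isUnit.map (c.kap 0)).ne_zero
  have hadm := congrArg (algebraMap k F) h
  rw [c.norm_eq _ 0, c.norm_eqK _ 0] at hadm
  simp only [zero_add] at hadm
  -- The columns multiply to the coordinates of `u`. The rows multiply to `μ₀` and `u₀ u₁ u₂ / μ₀`,
  -- the latter being `μ₁` by admissibility.
  obtain ⟨g, hg⟩ := c.surjS ![![c.kap 0 (μ : K), 1, 1],
    ![c.lam 0 (u : L) / c.kap 0 (μ : K), c.lam 1 (u : L), c.lam 2 (u : L)]]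
  have h1 : incl k K L F ((1 : K) ⊗ₜ (u : L)) = g * tauS σ L F g := c.extS fun i j => by
    rw [c.evS_incl, c.ev_tmul, map_one, one_mul, map_mul, c.evS_tau, hg, hg]
    fin_cases i <;> fin_cases j <;> simp <;> field_simp
  have hgu : IsUnit g := by
    refine isUnit_of_mul_isUnit_left (y := tauS σ L F g) ?_
    rw [← h1]
    exact (u.isUnit.map (Algebra.TensorProduct.includeRight : L →ₐ[k] K ⊗[k] L)).map _
  obtain ⟨g, rfl⟩ := hgu
  refine ⟨g, h1, c.extKS fun i => ?_⟩
  rw [c.kapS_norm i 0, hg, hg, hg]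
  fin_cases i
  · simp
  · simp
    field_simp
    linear_combination -hadm

/-- Hilbert 90 gives `f γ = v γ(v)⁻¹`. As `f γ` lies in `T`, the norms of `v` are invariant; if `w ∈
E` has the same norms, then `v⁻¹ w` lies in `T` and trivializes `f`. -/
theorem cocycles_le_of_forall_exists_norm [IsGalois k F]
    (h : ∀ (u : Lˣ) (μ : Kˣ), TitsProcess.Admissible k u μ →
      ∃ w : K ⊗[k] L, TitsProcess.normEL w = u ∧ Algebra.norm K w = μ) :
    GaloisH1.cocycles (F ≃ₐ[k] F) (UnitaryTorus.points σ L F) ≤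
      GaloisH1.coboundaries (F ≃ₐ[k] F) (UnitaryTorus.points σ L F) := by
  rintro f ⟨hf, hcoc⟩
  obtain ⟨v, hv⟩ := c.exists_coboundary (fun γ => (f γ : ((F ⊗[k] K) ⊗[k] L)ˣ))
    (hf.comp _) fun γ δ => congrArg
      (fun t : UnitaryTorus.points σ L F => ((t : ((F ⊗[k] K) ⊗[k] L)ˣ) : (F ⊗[k] K) ⊗[k] L))
      (hcoc γ δ)
  have hf1 : ∀ γ, ((f γ : ((F ⊗[k] K) ⊗[k] L)ˣ) : (F ⊗[k] K) ⊗[k] L) *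
      tauS σ L F ((f γ : ((F ⊗[k] K) ⊗[k] L)ˣ) : (F ⊗[k] K) ⊗[k] L) = 1 := fun γ => (f γ).2.1
  have hf2 : ∀ γ, Algebra.norm (F ⊗[k] K)
      ((f γ : ((F ⊗[k] K) ⊗[k] L)ˣ) : (F ⊗[k] K) ⊗[k] L) = 1 := fun γ => (f γ).2.2
  obtain ⟨u, μ, hadm, hu, hμ⟩ := c.exists_admissible v (fun γ => by
      rw [map_mul, gal_tauS]
      conv_rhs => rw [← hv γ, map_mul, mul_mul_mul_comm, hf1, one_mul]) (fun γ => by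
      rw [← norm_gal]
      conv_rhs => rw [← hv γ, map_mul, hf2, one_mul])
  obtain ⟨w, hw1, hw2⟩ := h u μ hadm
  have hw : IsUnit (incl k K L F w) := by
    refine isUnit_of_mul_isUnit_left (y := tauS σ L F (incl k K L F w)) ?_
    rw [c.incl_mul_tauS, hw1, hu]
    exact v.isUnit.mul (v.isUnit.map _)
  obtain ⟨w', hw'⟩ := hw
  have ht : v⁻¹ * w' ∈ UnitaryTorus.points σ L F := by
    have hvw : (v : (F ⊗[k] K) ⊗[k] L) * ((v⁻¹ * w' : ((F ⊗[k] K) ⊗[k] L)ˣ) :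
        (F ⊗[k] K) ⊗[k] L) = incl k K L F w := by
      rw [← Units.val_mul, mul_inv_cancel_left, hw']
    constructor
    · refine (v.isUnit.mul (v.isUnit.map (tauS σ L F))).mul_left_cancel ?_
      rw [mul_mul_mul_comm, ← map_mul, hvw, c.incl_mul_tauS, hw1, hu, mul_one]
    · refine (v.isUnit.map (Algebra.norm (F ⊗[k] K))).mul_left_cancel ?_
      rw [← map_mul, hvw, c.norm_incl, hw2, hμ, mul_one]
  refine ⟨⟨_, ht⟩, fun γ => Subtype.ext (Units.ext ?_)⟩
  have hγ : (Units.map (UnitaryTorus.gal K L γ : ((F ⊗[k] K) ⊗[k] L) →* _) w') = w' :=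
    Units.ext (by
      change UnitaryTorus.gal K L γ w' = w'
      rw [hw', gal_incl])
  have hv' : (f γ : ((F ⊗[k] K) ⊗[k] L)ˣ) *
      Units.map (UnitaryTorus.gal K L γ : ((F ⊗[k] K) ⊗[k] L) →* _) v = v := Units.ext (hv γ)
  change _ = (((v⁻¹ * w')⁻¹ *
    Units.map (UnitaryTorus.gal K L γ : ((F ⊗[k] K) ⊗[k] L) →* _) (v⁻¹ * w') :
      ((F ⊗[k] K) ⊗[k] L)ˣ) : (F ⊗[k] K) ⊗[k] L)
  congr 1
  rw [map_mul, map_inv, hγ, eq_mul_inv_of_mul_eq hv', mul_inv_rev, inv_inv]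
  rw [mul_comm w'⁻¹ v, mul_assoc, mul_comm _ w', inv_mul_cancel_left]

/-- With `g` over `F` of norms `(u, μ)`, write `g⁻¹ γ(g) = t⁻¹ γ(t)` with `t` in `T`. Then `g t⁻¹`
is invariant, so it lies in `E`, and it has the norms of `g`. -/
theorem exists_norm_of_cocycles_le [IsGalois k F]
    (h : GaloisH1.cocycles (F ≃ₐ[k] F) (UnitaryTorus.points σ L F) ≤
      GaloisH1.coboundaries (F ≃ₐ[k] F) (UnitaryTorus.points σ L F))
    {u : Lˣ} {μ : Kˣ} (hadm : TitsProcess.Admissible k u μ) :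
    ∃ w : K ⊗[k] L, TitsProcess.normEL w = u ∧ Algebra.norm K w = μ := by
  obtain ⟨g, hg1, hg2⟩ := c.exists_norms_eq hadm
  let ρ : (F ≃ₐ[k] F) → ((F ⊗[k] K) ⊗[k] L)ˣ →* ((F ⊗[k] K) ⊗[k] L)ˣ := fun γ =>
    Units.map (UnitaryTorus.gal K L γ : ((F ⊗[k] K) ⊗[k] L) →* _)
  have hρ : ∀ γ x, ((ρ γ x : ((F ⊗[k] K) ⊗[k] L)ˣ) : (F ⊗[k] K) ⊗[k] L) =
    UnitaryTorus.gal K L γ x := fun _ _ => rfl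
  have hmem : ∀ γ, g⁻¹ * ρ γ g ∈ UnitaryTorus.points σ L F := fun γ => by
    have hvw : (g : (F ⊗[k] K) ⊗[k] L) * ((g⁻¹ * ρ γ g : ((F ⊗[k] K) ⊗[k] L)ˣ) :
        (F ⊗[k] K) ⊗[k] L) = UnitaryTorus.gal K L γ g := by
      rw [← Units.val_mul, mul_inv_cancel_left, hρ]
    constructor
    · refine (g.isUnit.mul (g.isUnit.map (tauS σ L F))).mul_left_cancel ?_
      rw [mul_mul_mul_comm, ← map_mul, hvw, ← gal_tauS, ← map_mul, ← hg1, gal_incl, mul_one]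
    · refine (g.isUnit.map (Algebra.norm (F ⊗[k] K))).mul_left_cancel ?_
      rw [← map_mul, hvw, norm_gal, ← hg2, mul_one]
      simp
  have hf : (fun γ => (⟨_, hmem γ⟩ : UnitaryTorus.points σ L F)) ∈
      GaloisH1.cocycles (F ≃ₐ[k] F) (UnitaryTorus.points σ L F) := by
    have hmul : ∀ γ δ x, ρ (γ * δ) x = ρ γ (ρ δ x) := fun γ δ x =>
      Units.ext (UnitaryTorus.gal_mul K L γ δ x)
    refine ⟨(IsLocallyConstant.iff_eventually_eq _).2 fun γ => ?_, fun γ δ => Subtype.ext ?_⟩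
    · have h1 : Filter.Tendsto (fun δ => γ⁻¹ * δ) (nhds γ) (nhds (1 : F ≃ₐ[k] F)) := by
        have := (continuous_const_mul γ⁻¹).tendsto γ
        rwa [inv_mul_cancel] at this
      filter_upwards [h1.eventually (eventually_gal_eq (g : (F ⊗[k] K) ⊗[k] L))] with δ hδ
      refine Subtype.ext ?_
      have h2 : ρ (γ⁻¹ * δ) g = g := Units.ext hδ
      change g⁻¹ * ρ δ g = g⁻¹ * ρ γ g
      have h3 := hmul γ (γ⁻¹ * δ) g
      rw [mul_inv_cancel_left, h2] at h3
      rw [h3]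
    · change g⁻¹ * ρ (γ * δ) g = g⁻¹ * ρ γ g * ρ γ (g⁻¹ * ρ δ g)
      rw [map_mul, map_inv, hmul, mul_assoc, mul_inv_cancel_left]
  obtain ⟨⟨t, ht⟩, htf⟩ := h hf
  have ht1 : (t : (F ⊗[k] K) ⊗[k] L) * tauS σ L F t = 1 := ht.1
  have ht2 : Algebra.norm (F ⊗[k] K) (t : (F ⊗[k] K) ⊗[k] L) = 1 := ht.2
  have hfix : ∀ γ, ρ γ (g * t⁻¹) = g * t⁻¹ := fun γ => by
    have h1 : g⁻¹ * ρ γ g = t⁻¹ * ρ γ t := congrArg Subtype.val (htf γ)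
    rw [inv_mul_eq_iff_eq_mul] at h1
    rw [map_mul, map_inv, h1, mul_assoc, mul_inv_cancel_right]
  obtain ⟨w, hw⟩ := mem_range_incl ((g * t⁻¹ : ((F ⊗[k] K) ⊗[k] L)ˣ) : (F ⊗[k] K) ⊗[k] L)
    fun γ => congrArg Units.val (hfix γ)
  have hwt : incl k K L F w * t = g := by
    rw [hw, ← Units.val_mul, inv_mul_cancel_right]
  refine ⟨w, ?_, ?_⟩
  · have h1 : incl k K L F ((1 : K) ⊗ₜ TitsProcess.normEL w) =
        incl k K L F ((1 : K) ⊗ₜ (u : L)) := by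
      rw [hg1, ← hwt, map_mul, mul_mul_mul_comm, ht1, mul_one, c.incl_mul_tauS]
    refine c.extL fun j => ?_
    simpa using congrArg (c.ev 0 j) (c.incl_injective h1)
  · have h1 : (1 : F) ⊗ₜ[k] Algebra.norm K w = (1 : F) ⊗ₜ[k] (μ : K) := by
      rw [hg2, ← hwt, map_mul, ht2, mul_one, c.norm_incl]
    refine c.extK fun i => ?_
    simpa using congrArg (c.kapS i) h1

end Splitting

end EtaleCoordinates

/-! ### Conclusion. -/

theorem GaloisH1.subsingleton_iff (Γ M : Type*) [Group Γ] [TopologicalSpace Γ] [CommGroup M]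
    [MulDistribMulAction Γ M] :
    Subsingleton (GaloisH1 Γ M) ↔ GaloisH1.cocycles Γ M ≤ GaloisH1.coboundaries Γ M := by
  rw [QuotientGroup.subsingleton_iff, Subgroup.subgroupOf_eq_top]

theorem mainTheorem7 {k L K : Type*} [Field k] [CommRing L] [Algebra k L] [CommRing K]
    [Algebra k K] [Module.Finite k L] [Algebra.Etale k L] [Algebra.Etale k K]
    (hL : Module.finrank k L = 3) (hK : Module.finrank k K = 2)
    (σ : K ≃ₐ[k] K) (hσ : σ ≠ AlgEquiv.refl)
    (Ks : Type*) [Field Ks] [Algebra k Ks] [IsSepClosure k Ks] :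
    Subsingleton (GaloisH1 (Ks ≃ₐ[k] Ks) (UnitaryTorus.points σ L Ks)) ↔
      ∀ (u : Lˣ) (μ : Kˣ), TitsProcess.Admissible k u μ →
        TitsProcess.LIsomorphic σ u μ 1 1 := by
  have : Module.Finite k K := Module.finite_of_finrank_pos (by omega)
  have : IsSepClosed Ks := IsSepClosure.sep_closed k
  obtain ⟨c⟩ := EtaleCoordinates.Splitting.nonempty (F := Ks) hL hK hσ
  rw [GaloisH1.subsingleton_iff]
  constructor
  · intro h u μ hadm
    obtain ⟨w, hu, hμ⟩ := c.exists_norm_of_cocycles_le h hadm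
    exact c.lIsomorphic_one hu hμ
  · intro h
    exact c.cocycles_le_of_forall_exists_norm fun u μ hadm =>
      c.exists_norm_eq_of_lIsomorphic_one hadm (h u μ hadm)
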